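/- Let $\mathcal X=\mathbb C^N$, $\mathcal Y=\mathbb C^M$ with $NM\ge 2$; $\|\cdot\|$ is the spectral norm and $\langle A,B\rangle=\operatorname{Tr}(A^*B)$. An *interactive measurement operator* is an operator $Q=(\mathbb 1_{\mathcal Y}\otimes B^*)\,\Pi\,(\mathbb 1_{\mathcal Y}\otimes B)$ on $\mathcal Y\otimes\mathcal X$, where $\mathcal Z=\mathbb C^k$, $\sum_i|i\rangle|\psi_i\rangle\in\mathcal X\otimes\mathcal Z$ is a unit vector, $B=\sum_i|\psi_i\rangle\langle i|$, and $0\le\Pi\le\mathbb 1$ on $\mathcal Y\otimes\mathcal Z$. Put $\mu(Q)=\max_\Psi\langle Q,J(\Psi)\rangle$ over all quantum operations (completely positive trace-preserving maps) $\Psi:L(\mathcal X)\to L(\mathcal Y)$, where $J(\Psi)=\sum_{i,j}\Psi(|i\rangle\langle j|)\otimes|i\rangle\langle j|$. Let $Q$ be an invertible interactive measurement operator, $\varepsilon,\gamma>0$ real, and $$\Phi(X)=\operatorname{Tr}_{\mathcal Y}(Q^{-1/2}XQ^{-1/2}),\qquad \Phi^*(Y)=Q^{-1/2}(\mathbb 1_{\mathcal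 Y}\otimes Y)Q^{-1/2}.$$ Call $X$ *primal feasible* if $X\ge0$ and $\Phi(X)\le\mathbb 1_{\mathcal X}$, and $Y$ *dual feasible* if $Y\ge 0$ and $\Phi^*(Y)\ge\mathbb 1_{\mathcal Y\otimes\mathcal X}$. Let $\kappa(Q)=\|Q\|\|Q^{-1}\|$, $\delta=\varepsilon^2/(8\kappa(Q)^2)$, $T=\lceil 24\ln(NM)/(\varepsilon^3\gamma^3\delta)\rceil$, $\eta=\varepsilon\gamma/2$. *Algorithm.* For $t=0,\dots,T-1$: (a) with $W_t=\exp(-\eta\delta\,\Phi^*(Y_0+\cdots+Y_{t-1}))$ (so $W_0=\mathbb 1$) and $\rho_t=W_t/\operatorname{Tr}W_t$, compute a spectral decomposition $\Phi(\rho_t)=\sum_{j=1}^N\lambda_j|x_j\rangle\langle x_j|$; (b) let $S=\{j:\gamma\lambda_j>1\}$, $s=\sum_{j\in S}\lambda_j$; (c) if $s\le\delta\|Q^{-1}\|$, halt and accept; (d) let $Y_t=\frac1s\sum_{j\in S}|x_j\rangle\langle x_j|$. After iteration $T-1$, halt and reject. Then: 1. The maximum defining $\mu(Q)$ is attained. For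 every positive semidefinite $R$ on $\mathcal Y\otimes\mathcal X$, $|\mu(Q)-\mu(R)|\le N\|Q-R\|$; in particular $|\mu(Q)-\mu(R)|<\varepsilon\gamma$ if $\|Q-R\|<\varepsilon\gamma/N$. 2. Every run carries out at most $T$ iterations and accepts or rejects. If $\varepsilon,\gamma\le1$, then $T\le 25\ln(NM)/(\varepsilon^3\gamma^3\delta)$, so $T=O(\ln(NM)/(\varepsilon^3\gamma^3\delta))$. 3. (Exact computation.) An error-free run exists. For every error-free run, whatever spectral decompositions are chosen: if it accepts, there is a primal feasible $X$ with $\operatorname{Tr}X\ge(1-\varepsilon)\gamma$, and $\mu(Q)\ge(1-\varepsilon)\gamma$; if it rejects, there is a dual feasible $Y$ with $\operatorname{Tr}Y\le(1+\varepsilon)\gamma$, and $\mu(Q)\le(1+\varepsilon)\gamma$. 4. (Limited precision.) Consider a run in which, in iteration $t$, some stored operator $\widetilde\rho_t$ takes the place of $\rho_t$, and real numbers $\lambda_j$ and an orthonormal basis $(x_j)$ are used for which $\sum_j\lambda_j|x_j\rangle\langle x_j|$ is only an approximation of $\Phi(\widetilde\rho_t)$. - If it accepts in iteration $t$, $\widetilde\rho_t$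 is a density operator and $\|\Phi(\widetilde\rho_t)-\sum_j\lambda_j|x_j\rangle\langle x_j|\|<\delta/(4N\|Q^{-1}\|)$, then there is a primal feasible $X$ with $\operatorname{Tr}X\ge(1-2\varepsilon)\gamma$, and $\mu(Q)\ge(1-2\varepsilon)\gamma$. - If it rejects and, for all $t<T$, $\langle\rho_t,\Phi^*(Y_t)\rangle>1-\eta^2/12$, where $Y_t$ are the operators computed in the run and $\rho_t=W_t/\operatorname{Tr}W_t$ is formed exactly from $Y_0,\dots,Y_{t-1}$, then there is a dual feasible $Y$ with $\operatorname{Tr}Y\le(1+\varepsilon)\gamma$, and $\mu(Q)\le(1+\varepsilon)\gamma$. 5. These precision conditions can be met: there is $\tau>0$ (depending on $Q,\varepsilon,\gamma$) such that, if in every iteration $t$ carried out $\widetilde\rho_t=\widetilde W_t/\operatorname{Tr}\widetilde W_t$ with $\widetilde W_t$ Hermitian, $\|\widetilde W_t-W_t\|<\tau$, and the spectral decomposition has error $<\tau$ in spectral norm, then in every iteration carried out $\widetilde\rho_t$ is a density operator, the decomposition error is below $\delta/(4N\|Q^{-1}\|)$, and, unless the run accepts there, $\langle\rho_t,\Phi^*(Y_t)\rangle>1-\eta^2/12$.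 -/

import Mathlib

open scoped Matrix Kronecker ComplexOrder MatrixOrder Matrix.Norms.L2Operator

namespace QIP2

noncomputable section

/-! Throughout, `𝒳 = ℂ^N` and `𝒴 = ℂ^M`; operators on `𝒴 ⊗ 𝒳` are matrices indexed by
`Fin M × Fin N`, `≤` is the Loewner order and `‖·‖` is the spectral norm. -/

/-- Operators on `ℂ^N`. -/
abbrev Op (N : ℕ) : Type := Matrix (Fin N) (Fin N) ℂ

/-- Operators on `ℂ^M ⊗ ℂ^N`. -/
abbrev BiOp (M N : ℕ) : Type := Matrix (Fin M × Fin N) (Fin M × Fin N) ℂ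

/-- The (real part of the) Hilbert-Schmidt inner product `⟨A, B⟩ = Tr(A* B)`. -/
def hsInner {ι : Type} [Fintype ι] (A B : Matrix ι ι ℂ) : ℝ := ((Aᴴ * B).trace).re

/-- Density operators. -/
def IsDensity {ι : Type} [Fintype ι] (ρ : Matrix ι ι ℂ) : Prop :=
  ρ.PosSemidef ∧ ρ.trace = 1

/-- The partial trace `Tr_𝒴` on `𝒴 ⊗ 𝒳`. -/
def partialTrace {M N : ℕ} (A : BiOp M N) : Op N :=
  Matrix.of fun i j => ∑ a : Fin M, A (a, i) (a, j)

/-! ### Quantum operations and the maximum acceptance probability -/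

/-- `(Ψ ⊗ 𝟙_{L(ℂ^k)})(P)` for a super-operator `Ψ : L(𝒳) → L(𝒴)`. -/
def ampliation {M N : ℕ} (Ψ : Op N →ₗ[ℂ] Op M) (k : ℕ) (P : BiOp N k) : BiOp M k :=
  Matrix.of fun p q => Ψ (Matrix.of fun i j => P (i, p.2) (j, q.2)) p.1 q.1

/-- Completely positive super-operators. -/
def IsCompletelyPositive {M N : ℕ} (Ψ : Op N →ₗ[ℂ] Op M) : Prop :=
  ∀ (k : ℕ) (P : BiOp N k), P.PosSemidef → (ampliation Ψ k P).PosSemidef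

/-- Quantum operations: completely positive and trace-preserving super-operators. -/
def IsQuantumOperation {M N : ℕ} (Ψ : Op N →ₗ[ℂ] Op M) : Prop :=
  IsCompletelyPositive Ψ ∧ ∀ X : Op N, (Ψ X).trace = X.trace

/-- The Choi-Jamiołkowski representation `J(Ψ) = ∑ Ψ(|i⟩⟨j|) ⊗ |i⟩⟨j|`. -/
def choi {M N : ℕ} (Ψ : Op N →ₗ[ℂ] Op M) : BiOp M N :=
  ∑ i : Fin N, ∑ j : Fin N, Ψ (Matrix.single i j 1) ⊗ₖ Matrix.single i j (1 : ℂ)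

/-- The set of values `⟨Q, J(Ψ)⟩` over all quantum operations `Ψ`. -/
def acceptanceValues {M N : ℕ} (Q : BiOp M N) : Set ℝ :=
  {r | ∃ Ψ : Op N →ₗ[ℂ] Op M, IsQuantumOperation Ψ ∧ r = hsInner Q (choi Ψ)}

/-- `μ(Q)`, the maximum acceptance probability. -/
def mu {M N : ℕ} (Q : BiOp M N) : ℝ := sSup (acceptanceValues Q)

/-- `Q` is the interactive measurement operator `(𝟙 ⊗ B*) Π (𝟙 ⊗ B)` determined by a unit vector
`ψ ∈ 𝒳 ⊗ 𝒵` and a measurement operator `0 ≤ Π ≤ 𝟙` on `𝒴 ⊗ 𝒵`, where `𝒵 = ℂ^k`,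
`ψ = ∑ |i⟩|ψ_i⟩` and `B = ∑ |ψ_i⟩⟨i|`. -/
def IsInteractiveMeasurement {M N : ℕ} (Q : BiOp M N) : Prop :=
  ∃ (k : ℕ) (ψ : Fin N × Fin k → ℂ) (Pi : BiOp M k),
    ∑ p, ‖ψ p‖ ^ 2 = 1 ∧ 0 ≤ Pi ∧ Pi ≤ 1 ∧
    Q = ((1 : Op M) ⊗ₖ (Matrix.of fun (z : Fin k) (i : Fin N) => ψ (i, z))ᴴ) * Pi *
        ((1 : Op M) ⊗ₖ (Matrix.of fun (z : Fin k) (i : Fin N) => ψ (i, z)))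

/-! ### The semidefinite program -/

/-- `Q^{-1/2}`. -/
def invSqrt {M N : ℕ} (Q : BiOp M N) : BiOp M N := (CFC.sqrt Q)⁻¹

/-- `Φ(X) = Tr_𝒴(Q^{-1/2} X Q^{-1/2})`. -/
def Phi {M N : ℕ} (Q X : BiOp M N) : Op N := partialTrace (invSqrt Q * X * invSqrt Q)

/-- `Φ*(Y) = Q^{-1/2} (𝟙_𝒴 ⊗ Y) Q^{-1/2}`. -/
def PhiStar {M N : ℕ} (Q : BiOp M N) (Y : Op N) : BiOp M N :=
  invSqrt Q * ((1 : Op M) ⊗ₖ Y) * invSqrt Q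

/-- Feasibility for the primal problem: maximize `Tr X` subject to `Φ(X) ≤ 𝟙`, `X ≥ 0`. -/
def PrimalFeasible {M N : ℕ} (Q X : BiOp M N) : Prop := 0 ≤ X ∧ Phi Q X ≤ 1

/-- Feasibility for the dual problem: minimize `Tr Y` subject to `Φ*(Y) ≥ 𝟙`, `Y ≥ 0`. -/
def DualFeasible {M N : ℕ} (Q : BiOp M N) (Y : Op N) : Prop := 0 ≤ Y ∧ 1 ≤ PhiStar Q Y

/-! ### The algorithm -/

/-- The condition number `κ(Q) = ‖Q‖ ‖Q⁻¹‖`. -/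
def kappa {M N : ℕ} (Q : BiOp M N) : ℝ := ‖Q‖ * ‖Q⁻¹‖

/-- `δ = ε² / (8 κ(Q)²)`. -/
def delta {M N : ℕ} (Q : BiOp M N) (ε : ℝ) : ℝ := ε ^ 2 / (8 * kappa Q ^ 2)

/-- `T = ⌈24 ln(NM) / (ε³ γ³ δ)⌉`. -/
def bigT {M N : ℕ} (Q : BiOp M N) (ε γ : ℝ) : ℕ :=
  ⌈24 * Real.log ((N : ℝ) * M) / (ε ^ 3 * γ ^ 3 * delta Q ε)⌉₊

/-- What is computed in one iteration: the stored operator `rho`, and the spectral decomposition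
`∑ lam j |x_j⟩⟨x_j|` returned for `Φ(rho)`, where `x_j` is the `j`-th column of `U`. -/
structure Record (M N : ℕ) where
  rho : BiOp M N
  U : Matrix.unitaryGroup (Fin N) ℂ
  lam : Fin N → ℝ

namespace Record

variable {M N : ℕ}

/-- `|x_j⟩⟨x_j|`. -/
def ketbra (r : Record M N) (j : Fin N) : Op N :=
  Matrix.vecMulVec (fun i => (r.U : Op N) i j) (star fun i => (r.U : Op N) i j)

/-- The operator `∑ lam j |x_j⟩⟨x_j|`. -/
def decomp (r : Record M N) : Op N := ∑ j, (r.lam j : ℂ) • r.ketbra j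

/-- `S = {j : γ lam j > 1}`. -/
def bigS (γ : ℝ) (r : Record M N) : Finset (Fin N) := {j | γ * r.lam j > 1}

/-- `s = ∑_{j ∈ S} lam j`. -/
def smallS (γ : ℝ) (r : Record M N) : ℝ := ∑ j ∈ r.bigS γ, r.lam j

/-- The test `s ≤ δ ‖Q⁻¹‖`, which makes the algorithm halt and accept. -/
def AcceptTest (Q : BiOp M N) (ε γ : ℝ) (r : Record M N) : Prop :=
  r.smallS γ ≤ delta Q ε * ‖Q⁻¹‖

/-- `Y_t = (1/s) ∑_{j ∈ S} |x_j⟩⟨x_j|`. -/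
def Y (γ : ℝ) (r : Record M N) : Op N := ((1 / r.smallS γ : ℝ) : ℂ) • ∑ j ∈ r.bigS γ, r.ketbra j

end Record

/-! A run of the algorithm is a sequence `e` of records, one for each iteration; the entries after
the halting iteration play no role. -/

section Run

variable {M N : ℕ}

/-- `W_t = exp(-(εγδ/2) Φ*(Y_0 + ⋯ + Y_{t-1}))`; in particular `W_0 = 𝟙`. -/
def bigW (Q : BiOp M N) (ε γ : ℝ) (e : ℕ → Record M N) (t : ℕ) : BiOp M N :=
  NormedSpace.exp
    (((-(ε * γ * delta Q ε / 2) : ℝ) : ℂ) • PhiStar Q (∑ i ∈ Finset.range t, (e i).Y γ))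

/-- `W / Tr W`. -/
def normalize (W : BiOp M N) : BiOp M N := (W.trace)⁻¹ • W

/-- Iteration `t` is carried out: `t < T`, and the algorithm has not halted before. -/
def Reached (Q : BiOp M N) (ε γ : ℝ) (e : ℕ → Record M N) (t : ℕ) : Prop :=
  t < bigT Q ε γ ∧ ∀ i < t, ¬ (e i).AcceptTest Q ε γ

/-- The algorithm halts and accepts in iteration `t`. -/
def AcceptsAt (Q : BiOp M N) (ε γ : ℝ) (e : ℕ → Record M N) (t : ℕ) : Prop :=
  Reached Q ε γ e t ∧ (e t).AcceptTest Q ε γ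

/-- The algorithm goes through all `T` iterations without accepting, and rejects. -/
def Rejects (Q : BiOp M N) (ε γ : ℝ) (e : ℕ → Record M N) : Prop :=
  ∀ t < bigT Q ε γ, ¬ (e t).AcceptTest Q ε γ

/-- The number of iterations carried out. -/
def iterations (Q : BiOp M N) (ε γ : ℝ) (e : ℕ → Record M N) : ℕ :=
  {t | Reached Q ε γ e t}.ncard

/-- Error-free runs: `rho` is `ρ_t = W_t / Tr W_t` and the spectral decomposition is exact. -/
def IsExactRun (Q : BiOp M N) (ε γ : ℝ) (e : ℕ → Record M N) : Prop :=
  ∀ t, Reached Q ε γ e t →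
    (e t).rho = normalize (bigW Q ε γ e t) ∧ Phi Q (e t).rho = (e t).decomp

/-- Precision used for acceptance: the stored `rho` is some density operator, and the spectral
decomposition of `Φ(rho)` has error below `δ / (4 N ‖Q⁻¹‖)`. -/
def AcceptPrecision (Q : BiOp M N) (ε : ℝ) (r : Record M N) : Prop :=
  IsDensity r.rho ∧ ‖Phi Q r.rho - r.decomp‖ < delta Q ε / (4 * N * ‖Q⁻¹‖)

/-- Precision used for rejection: `⟨ρ_t, Φ*(Y_t)⟩ > 1 - η²/12` with `η = εγ/2`, where
`ρ_t = W_t / Tr W_t` is the exact operator determined by the computed `Y_0, …, Y_{t-1}`. -/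
def RejectPrecision (Q : BiOp M N) (ε γ : ℝ) (e : ℕ → Record M N) (t : ℕ) : Prop :=
  hsInner (normalize (bigW Q ε γ e t)) (PhiStar Q ((e t).Y γ)) > 1 - (ε * γ / 2) ^ 2 / 12

/-- Runs in which every matrix exponential and every spectral decomposition is computed up to an
error below `τ` in spectral norm. -/
def IsApproxRun (Q : BiOp M N) (ε γ τ : ℝ) (e : ℕ → Record M N) : Prop :=
  ∀ t, Reached Q ε γ e t →
    (∃ W : BiOp M N, W.IsHermitian ∧ ‖W - bigW Q ε γ e t‖ < τ ∧ (e t).rho = normalize W) ∧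
    ‖Phi Q (e t).rho - (e t).decomp‖ < τ

end Run

end

end QIP2

/-! The Choi matrices of quantum operations are exactly the `J ≥ 0` with `Tr_𝒴 J = 1`, a compact
set, so `μ(Q)` is the maximum of a linear functional. The substitution `J = Q^{-1/2} X Q^{-1/2}`
turns `⟨Q, J⟩` into `Tr X`. Hence a primal feasible `X` certifies `Tr X ≤ μ(Q)` and a dual feasible
`Y` certifies `μ(Q) ≤ Tr Y`; the algorithm only has to yield the right certificate whichever way it
halts.

On acceptance, the eigenvectors of `Φ(ρ)` with eigenvalue above `1/γ` carry little weight.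
Projecting them out of `Q^{-1/2} ρ Q^{-1/2}` and rescaling by about `γ` gives a primal feasible
operator; Cauchy–Schwarz for the Hilbert–Schmidt inner product shows that little trace is lost
(`exists_primalFeasible_of_decomp`).

On rejection, every `Y_t` has trace at most `γ`, `⟨ρ_t, Φ*(Y_t)⟩` is essentially `1`, and the failed
acceptance test gives `δ Φ*(Y_t) ≤ 1`. These operators are losses for the matrix multiplicative
weights method: by Golden–Thompson each of them shrinks `Tr W_t` by a fixed factor
(`trace_exp_neg_sum_le`). The largest eigenvalue of `W_T` is at most its trace, so the average of
the `Φ*(Y_t)` is bounded below by nearly `1`, and a factor `1 + ε` makes the average of the `Y_t`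
dual feasible (`exists_dualFeasible_of_rejects`).

As long as no test has passed, `W_t ≥ exp(-ηT)`, uniformly over all runs. This makes normalization
stable, and one error bound `τ` serves all iterations (`exists_precision`). -/

namespace QIP2

open Filter Topology

/-! ### The Lie–Trotter product formula -/

section LieTrotter

variable {𝔸 : Type*} [NormedRing 𝔸] [NormOneClass 𝔸]

theorem norm_pow_sub_pow_le {u v : 𝔸} {c : ℝ} (hu : ‖u‖ ≤ c) (hv : ‖v‖ ≤ c) (n : ℕ) :
    ‖u ^ (n + 1) - v ^ (n + 1)‖ ≤ (n + 1) * ‖u - v‖ * c ^ n := by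
  have hc : 0 ≤ c := (norm_nonneg u).trans hu
  induction n with
  | zero => simp
  | succ n ih =>
    have h : u ^ (n + 1 + 1) - v ^ (n + 1 + 1) =
        (u ^ (n + 1) - v ^ (n + 1)) * u + v ^ (n + 1) * (u - v) := by
      rw [pow_succ u, pow_succ v (n + 1)]; noncomm_ring
    rw [h]
    have h1 : ‖(u ^ (n + 1) - v ^ (n + 1)) * u‖ ≤ (n + 1) * ‖u - v‖ * c ^ n * c :=
      (norm_mul_le _ _).trans (mul_le_mul ih hu (norm_nonneg _) (by positivity))
    have h2 : ‖v ^ (n + 1) * (u - v)‖ ≤ c ^ (n + 1) * ‖u - v‖ :=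
      (norm_mul_le _ _).trans (mul_le_mul_of_nonneg_right
        ((norm_pow_le v _).trans (pow_le_pow_left₀ (norm_nonneg _) hv _)) (norm_nonneg _))
    refine (norm_add_le _ _).trans ((add_le_add h1 h2).trans (le_of_eq ?_))
    push_cast
    ring

variable [NormedAlgebra ℝ 𝔸]

/-- Two curves through `1` with the same derivative have the same asymptotic `n`-th powers. -/
theorem tendsto_pow_sub_pow_of_hasDerivAt {f g : ℝ → 𝔸} {D : 𝔸} (hf : HasDerivAt f D 0)
    (hg : HasDerivAt g D 0) (hf0 : f 0 = 1) (hg0 : g 0 = 1) :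
    Tendsto (fun n : ℕ => f ((n : ℝ)⁻¹) ^ n - g ((n : ℝ)⁻¹) ^ n) atTop (𝓝 0) := by
  have hlim : Tendsto (fun n : ℕ => ((n : ℝ)⁻¹)) atTop (𝓝 0) := tendsto_inv_atTop_nhds_zero_nat
  -- Linear growth near `0` keeps the powers bounded: at `s = 1/n` this gives `‖k s‖ ^ n ≤ exp (‖D‖
  -- + 1)`.
  have hO : ∀ {k : ℝ → 𝔸}, HasDerivAt k D 0 → k 0 = 1 →
      ∀ᶠ s in 𝓝 (0 : ℝ), ‖k s‖ ≤ 1 + (‖D‖ + 1) * |s| := by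
    intro k hk hk0
    have h := (hasDerivAt_iff_isLittleO_nhds_zero.mp hk).def one_pos
    filter_upwards [h] with s hs
    simp only [zero_add, hk0, one_mul, Real.norm_eq_abs] at hs
    calc ‖k s‖ = ‖(k s - 1 - s • D) + (1 + s • D)‖ := by congr 1; abel
      _ ≤ |s| + (1 + |s| * ‖D‖) := by
        refine (norm_add_le _ _).trans (add_le_add hs ((norm_add_le _ _).trans ?_))
        rw [norm_one, norm_smul, Real.norm_eq_abs]
      _ = _ := by ring
  have hdiff : HasDerivAt (fun s => f s - g s) 0 0 := by
    have h := hf.sub hg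
    rw [sub_self] at h
    exact h
  rw [tendsto_zero_iff_norm_tendsto_zero]
  rw [Metric.tendsto_nhds]
  intro e he
  set C := ‖D‖ + 1 with hC
  have hCpos : 0 ≤ C := by positivity
  -- The telescoping bound contributes a factor `n`, cancelled by `s = 1/n`, and a power below `exp
  -- C`; this choice leaves `e / 2`.
  set e' := e / (2 * Real.exp C) with he'
  have he'pos : 0 < e' := by positivity
  have h := (hasDerivAt_iff_isLittleO_nhds_zero.mp hdiff).def he'pos
  filter_upwards [hlim.eventually h, hlim.eventually (hO hf hf0), hlim.eventually (hO hg hg0),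
    eventually_ge_atTop 1] with n h1 h2 h3 hn
  obtain ⟨m, rfl⟩ : ∃ m, n = m + 1 := ⟨n - 1, by omega⟩
  have hpos : (0 : ℝ) < ((m + 1 : ℕ) : ℝ) := by positivity
  simp only [zero_add, hf0, hg0, sub_self, smul_zero, sub_zero, Real.norm_eq_abs,
    abs_of_pos (inv_pos.mpr hpos)] at h1 h2 h3
  have hle := norm_pow_sub_pow_le h2 h3 m
  have hexp : (1 + C * ((m + 1 : ℕ) : ℝ)⁻¹) ^ m ≤ Real.exp C := by
    calc (1 + C * ((m + 1 : ℕ) : ℝ)⁻¹) ^ m ≤ (1 + C * ((m + 1 : ℕ) : ℝ)⁻¹) ^ (m + 1) := by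
          apply pow_le_pow_right₀ _ (Nat.le_succ m)
          have : 0 ≤ C * ((m + 1 : ℕ) : ℝ)⁻¹ := by positivity
          linarith
      _ ≤ (Real.exp (C * ((m + 1 : ℕ) : ℝ)⁻¹)) ^ (m + 1) := by
          apply pow_le_pow_left₀ (by positivity)
          linarith [Real.add_one_le_exp (C * ((m + 1 : ℕ) : ℝ)⁻¹)]
      _ = Real.exp C := by
          rw [← Real.exp_nat_mul]; congr 1; field_simp
  rw [dist_zero_right, norm_norm]
  calc _ ≤ _ := hle
    _ ≤ ((m : ℝ) + 1) * (e' * ((m + 1 : ℕ) : ℝ)⁻¹) * Real.exp C := by gcongr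
    _ = e / 2 := by rw [he']; push_cast; field_simp
    _ < e := by linarith

/-- The Lie–Trotter product formula. -/
theorem lie_trotter [CompleteSpace 𝔸] (a b : 𝔸) :
    Tendsto (fun n : ℕ => (NormedSpace.exp ((n : ℝ)⁻¹ • a) * NormedSpace.exp ((n : ℝ)⁻¹ • b)) ^ n)
      atTop (𝓝 (NormedSpace.exp (a + b))) := by
  let _ : NormedAlgebra ℚ 𝔸 := NormedAlgebra.restrictScalars ℚ ℝ 𝔸
  have hder : ∀ c : 𝔸, HasDerivAt (fun s : ℝ => NormedSpace.exp (s • c)) c 0 := fun c => by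
    simpa using hasDerivAt_exp_smul_const (𝕂 := ℝ) c 0
  have hf : HasDerivAt (fun s : ℝ => NormedSpace.exp (s • a) * NormedSpace.exp (s • b)) (a + b) 0 := by
    have h := (hder a).mul (hder b)
    simp only [zero_smul, NormedSpace.exp_zero, mul_one, one_mul] at h
    exact h
  have h := tendsto_pow_sub_pow_of_hasDerivAt hf (hder (a + b)) (by simp) (by simp)
  have h2 : ∀ᶠ n : ℕ in atTop,
      (NormedSpace.exp ((n : ℝ)⁻¹ • (a + b))) ^ n = NormedSpace.exp (a + b) := by
    filter_upwards [eventually_ge_atTop 1] with n hn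
    have hn0 : (n : ℝ) ≠ 0 := by positivity
    rw [← NormedSpace.exp_nsmul, ← Nat.cast_smul_eq_nsmul ℝ, smul_smul, mul_inv_cancel₀ hn0,
      one_smul]
  have h3 := h.add (tendsto_const_nhds (x := NormedSpace.exp (a + b)))
  rw [zero_add] at h3
  refine h3.congr' ?_
  filter_upwards [h2] with n hn
  rw [hn, sub_add_cancel]

end LieTrotter

/-! ### Trace inequalities and Golden–Thompson -/

section Trace

variable {ι : Type*} [Fintype ι]

theorem trace_mul_conjTranspose_re_nonneg (A : Matrix ι ι ℂ) : 0 ≤ (A * Aᴴ).trace.re :=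
  (Complex.nonneg_iff.mp (Matrix.posSemidef_self_mul_conjTranspose A).trace_nonneg).1

theorem trace_conjTranspose_re (A : Matrix ι ι ℂ) : Aᴴ.trace.re = A.trace.re := by
  simp [Matrix.trace_conjTranspose]

/-- Expand the squared Hilbert–Schmidt norm of `A - Bᴴ`, which is nonnegative. -/
theorem two_mul_trace_mul_le (A B : Matrix ι ι ℂ) :
    2 * (A * B).trace.re ≤ (A * Aᴴ).trace.re + (Bᴴ * B).trace.re := by
  have h := trace_mul_conjTranspose_re_nonneg (A - Bᴴ)
  have h2 : (Bᴴ * Aᴴ).trace.re = (A * B).trace.re := by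
    rw [← Matrix.conjTranspose_mul, trace_conjTranspose_re]
  simp only [Matrix.conjTranspose_sub, Matrix.conjTranspose_conjTranspose, sub_mul, mul_sub,
    Matrix.trace_sub, Complex.sub_re, h2] at h
  linarith

variable [DecidableEq ι]

theorem trace_mul_pow_comm (A B : Matrix ι ι ℂ) (m : ℕ) :
    ((A * B) ^ m).trace = ((B * A) ^ m).trace := by
  cases m with
  | zero => simp
  | succ m =>
    have h : ∀ k : ℕ, (A * B) ^ k * A = A * (B * A) ^ k := fun k => by
      induction k with
      | zero => simp
      | succ k ih => rw [pow_succ', mul_assoc, ih, pow_succ']; simp only [mul_assoc]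
    rw [pow_succ, ← mul_assoc, h, mul_assoc, Matrix.trace_mul_comm, pow_succ, mul_assoc]

/-- The two inequalities feed each other in one induction. For the first, apply it at level `k` to
`Z ^ 2`; by cyclicity this leads to `Tr ((Z Zᴴ)(Zᴴ Z)) ^ 2 ^ k`. The second at level `k` separates
the factors, and `two_mul_trace_mul_le` bounds the result by the mean of two equal traces. For the
second, the first at level `k`, applied to `X Y`, leads to `Tr (Y² X²) ^ 2 ^ k`, to which the second
at level `k` applies. -/
theorem trace_pow_le_and_trace_mul_pow_le (k : ℕ) :
    (∀ Z : Matrix ι ι ℂ, (Z ^ 2 ^ (k + 1)).trace.re ≤ ((Z * Zᴴ) ^ 2 ^ k).trace.re) ∧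
    (∀ X Y : Matrix ι ι ℂ, X.IsHermitian → Y.IsHermitian →
      ((X * Y) ^ 2 ^ k).trace.re ≤ (X ^ 2 ^ k * Y ^ 2 ^ k).trace.re) := by
  induction k with
  | zero =>
    refine ⟨fun Z => ?_, fun X Y _ _ => by simp⟩
    have := two_mul_trace_mul_le Z Z
    rw [Matrix.trace_mul_comm Zᴴ Z] at this
    simp only [zero_add, pow_one, pow_zero, pow_two]
    linarith
  | succ k ih =>
    obtain ⟨ih1, ih2⟩ := ih
    constructor
    · intro Z
      have h1 := ih1 (Z ^ 2)
      rw [← pow_mul, ← pow_succ'] at h1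
      have h2 : Z ^ 2 * (Z ^ 2)ᴴ = Z * (Z * Zᴴ * Zᴴ) := by
        simp only [pow_two, Matrix.conjTranspose_mul, mul_assoc]
      rw [h2, trace_mul_pow_comm, mul_assoc (Z * Zᴴ)] at h1
      have hX := Matrix.isHermitian_mul_conjTranspose_self Z
      have hY := Matrix.isHermitian_conjTranspose_mul_self Z
      have h3 := ih2 _ _ hX hY
      have h4 := two_mul_trace_mul_le ((Z * Zᴴ) ^ 2 ^ k) ((Zᴴ * Z) ^ 2 ^ k)
      rw [(hX.pow _).eq, (hY.pow _).eq, ← pow_add, ← pow_add, ← two_mul, ← pow_succ',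
        trace_mul_pow_comm Zᴴ Z] at h4
      linarith
    · intro X Y hX hY
      have h1 := ih1 (X * Y)
      have h2 : X * Y * (X * Y)ᴴ = X * (Y ^ 2 * X) := by
        simp only [pow_two, Matrix.conjTranspose_mul, hX.eq, hY.eq, mul_assoc]
      rw [h2, trace_mul_pow_comm X (Y ^ 2 * X), mul_assoc, ← pow_two] at h1
      have h3 := ih2 _ _ (hY.pow 2) (hX.pow 2)
      rw [← pow_mul, ← pow_mul, ← pow_succ', Matrix.trace_mul_comm] at h3
      exact h1.trans h3

/-- The Golden–Thompson inequality. -/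
theorem golden_thompson [Nonempty ι] {A B : Matrix ι ι ℂ} (hA : A.IsHermitian)
    (hB : B.IsHermitian) :
    (NormedSpace.exp (A + B)).trace.re ≤ (NormedSpace.exp A * NormedSpace.exp B).trace.re := by
  -- The trace inequality is available only for exponents `2 ^ k`, so the limit is taken along that
  -- subsequence.
  have hlim := (lie_trotter A B).comp (tendsto_pow_atTop_atTop_of_one_lt (one_lt_two : 1 < 2))
  have hcont : Continuous fun X : Matrix ι ι ℂ => X.trace.re :=
    Complex.continuous_re.comp (continuous_id.matrix_trace)
  refine le_of_tendsto ((hcont.tendsto _).comp hlim) (Eventually.of_forall fun k => ?_)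
  have hH : ∀ {C : Matrix ι ι ℂ}, C.IsHermitian → ∀ r : ℝ,
      (NormedSpace.exp (r • C)).IsHermitian := fun hC r =>
    Matrix.IsHermitian.exp (by
      rw [Matrix.IsHermitian, Matrix.conjTranspose_smul, hC.eq, star_trivial])
  have h := (trace_pow_le_and_trace_mul_pow_le k).2 _ _
    (hH hA (((2 ^ k : ℕ) : ℝ)⁻¹)) (hH hB (((2 ^ k : ℕ) : ℝ)⁻¹))
  have hpow : ∀ C : Matrix ι ι ℂ,
      NormedSpace.exp ((((2 ^ k : ℕ) : ℝ)⁻¹) • C) ^ 2 ^ k = NormedSpace.exp C := fun C => by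
    rw [← Matrix.exp_nsmul, ← Nat.cast_smul_eq_nsmul ℝ, smul_smul, mul_inv_cancel₀ (by positivity),
      one_smul]
  rw [hpow, hpow] at h
  exact h

end Trace

/-! ### Loewner order, traces and functional calculus -/

section Order

variable {ι : Type*}

theorem isHermitian_of_nonneg {A : Matrix ι ι ℂ} (hA : 0 ≤ A) : A.IsHermitian :=
  (Matrix.nonneg_iff_posSemidef.mp hA).isHermitian

theorem smul_isHermitian {A : Matrix ι ι ℂ} (hA : A.IsHermitian) (r : ℝ) :
    (r • A).IsHermitian := by
  rw [Matrix.IsHermitian, Matrix.conjTranspose_smul, hA.eq, star_trivial]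

variable [Fintype ι]

theorem trace_re_nonneg {A : Matrix ι ι ℂ} (hA : 0 ≤ A) : 0 ≤ A.trace.re :=
  (Complex.nonneg_iff.mp (Matrix.nonneg_iff_posSemidef.mp hA).trace_nonneg).1

theorem trace_real_smul_re (r : ℝ) (A : Matrix ι ι ℂ) : (r • A).trace.re = r * A.trace.re := by
  simp [Matrix.trace_smul]

theorem conjTranspose_mul_mul_le {κ : Type*} [Fintype κ] {A B : Matrix ι ι ℂ} (h : A ≤ B)
    (C : Matrix ι κ ℂ) : Cᴴ * A * C ≤ Cᴴ * B * C := by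
  rw [Matrix.le_iff] at h ⊢
  have := h.conjTranspose_mul_mul_same C
  rwa [Matrix.mul_sub, Matrix.sub_mul] at this

variable [DecidableEq ι]

theorem trace_mul_re_nonneg {A B : Matrix ι ι ℂ} (hA : 0 ≤ A) (hB : 0 ≤ B) :
    0 ≤ (A * B).trace.re := by
  obtain ⟨C, hC⟩ := CStarAlgebra.nonneg_iff_eq_mul_star_self.mp hB
  have h : 0 ≤ Cᴴ * A * C := by
    simpa using conjTranspose_mul_mul_le hA C
  have h2 := trace_re_nonneg h
  rwa [Matrix.trace_mul_comm, ← mul_assoc, Matrix.trace_mul_comm, ← Matrix.star_eq_conjTranspose,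
    ← hC] at h2

theorem trace_mul_re_mono {A B C : Matrix ι ι ℂ} (h : A ≤ B) (hC : 0 ≤ C) :
    (A * C).trace.re ≤ (B * C).trace.re := by
  have := trace_mul_re_nonneg (sub_nonneg.mpr h) hC
  rw [sub_mul, Matrix.trace_sub, Complex.sub_re] at this
  linarith

theorem trace_re_mono {A B : Matrix ι ι ℂ} (h : A ≤ B) : A.trace.re ≤ B.trace.re := by
  simpa using trace_mul_re_mono h (C := 1) zero_le_one

theorem trace_one_re : (1 : Matrix ι ι ℂ).trace.re = Fintype.card ι := by
  simp [Matrix.trace_one]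

theorem le_norm_smul_one {A : Matrix ι ι ℂ} (hA : A.IsHermitian) : A ≤ ‖A‖ • 1 := by
  have := IsSelfAdjoint.le_algebraMap_norm_self (a := A) hA
  rwa [Algebra.algebraMap_eq_smul_one] at this

theorem abs_trace_mul_re_le {A B : Matrix ι ι ℂ} (hA : A.IsHermitian) (hB : 0 ≤ B) :
    |(A * B).trace.re| ≤ ‖A‖ * B.trace.re := by
  have key : ∀ {C : Matrix ι ι ℂ}, C.IsHermitian → (C * B).trace.re ≤ ‖C‖ * B.trace.re := by
    intro C hC
    have := trace_mul_re_mono (le_norm_smul_one hC) hB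
    rwa [smul_mul_assoc, one_mul, trace_real_smul_re] at this
  rw [abs_le]
  have h := key hA.neg
  rw [norm_neg, neg_mul, Matrix.trace_neg, Complex.neg_re] at h
  exact ⟨by linarith, key hA⟩

theorem le_trace_smul_one {A : Matrix ι ι ℂ} (hA : 0 ≤ A) : A ≤ A.trace.re • 1 := by
  have hp := Matrix.nonneg_iff_posSemidef.mp hA
  rw [← Algebra.algebraMap_eq_smul_one]
  refine le_algebraMap_of_spectrum_le (fun x hx => ?_) hp.isHermitian
  rw [hp.isHermitian.spectrum_real_eq_range_eigenvalues] at hx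
  obtain ⟨i, rfl⟩ := hx
  rw [hp.isHermitian.trace_eq_sum_eigenvalues]
  simp only [Complex.coe_algebraMap, Complex.re_sum, Complex.ofReal_re]
  exact Finset.single_le_sum (f := hp.isHermitian.eigenvalues)
    (fun j _ => hp.eigenvalues_nonneg j) (Finset.mem_univ i)

theorem norm_le_of_le_smul_one {A : Matrix ι ι ℂ} (hA : 0 ≤ A) {r : ℝ} (hr : 0 ≤ r)
    (h : A ≤ r • 1) : ‖A‖ ≤ r := by
  rw [CStarAlgebra.norm_le_iff_le_algebraMap A hr hA, Algebra.algebraMap_eq_smul_one]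
  exact h

theorem norm_le_trace_re {A : Matrix ι ι ℂ} (hA : 0 ≤ A) : ‖A‖ ≤ A.trace.re :=
  norm_le_of_le_smul_one hA (trace_re_nonneg hA) (le_trace_smul_one hA)

theorem abs_trace_re_le {A : Matrix ι ι ℂ} (hA : A.IsHermitian) :
    |A.trace.re| ≤ Fintype.card ι * ‖A‖ := by
  have := abs_trace_mul_re_le hA (B := 1) zero_le_one
  rwa [mul_one, trace_one_re, mul_comm] at this

theorem exp_nonneg {A : Matrix ι ι ℂ} (hA : A.IsHermitian) : 0 ≤ NormedSpace.exp A := by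
  rw [← CFC.real_exp_eq_normedSpace_exp (a := A) hA]
  exact cfc_nonneg fun x _ => (Real.exp_pos x).le

/-- On the spectrum `-c ≤ x ≤ 0`: from `exp (-x) ≥ 1 - x` follows `exp x ≤ 1 + x exp x`, and `x exp
x ≤ x exp (-c)` because `x ≤ 0`. -/
theorem exp_le_one_add_smul {A : Matrix ι ι ℂ} {c : ℝ} (h1 : -(c • 1) ≤ A) (h2 : A ≤ 0) :
    NormedSpace.exp A ≤ 1 + Real.exp (-c) • A := by
  have hA : IsSelfAdjoint A := by
    have h := (isHermitian_of_nonneg (sub_nonneg.mpr h2)).neg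
    rw [zero_sub, neg_neg] at h
    exact h
  have h3 : algebraMap ℝ (Matrix ι ι ℂ) (-c) ≤ A := by
    rwa [Algebra.algebraMap_eq_smul_one, neg_smul]
  have h4 : A ≤ algebraMap ℝ (Matrix ι ι ℂ) 0 := by simpa using h2
  rw [algebraMap_le_iff_le_spectrum hA] at h3
  rw [le_algebraMap_iff_spectrum_le hA] at h4
  have h5 : 1 + Real.exp (-c) • A = cfc (fun x : ℝ => 1 + Real.exp (-c) * x) A := by
    rw [cfc_const_add (1 : ℝ) (fun x : ℝ => Real.exp (-c) * x) A, cfc_const_mul_id _ _ hA]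
    simp
  rw [h5, ← CFC.real_exp_eq_normedSpace_exp (a := A) hA]
  refine cfc_mono fun x hx => ?_
  have hx1 := h3 x hx
  have hx2 := h4 x hx
  have e1 : Real.exp (-c) ≤ Real.exp x := Real.exp_le_exp.mpr hx1
  have e2 : 1 - x ≤ Real.exp (-x) := by linarith [Real.add_one_le_exp (-x)]
  have e3 : Real.exp x * Real.exp (-x) = 1 := by rw [← Real.exp_add]; simp
  nlinarith [Real.exp_pos x, mul_le_mul_of_nonneg_left e2 (Real.exp_pos x).le,
    mul_le_mul_of_nonneg_right e1 (neg_nonneg.mpr hx2)]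

theorem exp_smul_one_le_exp {A : Matrix ι ι ℂ} (hA : A.IsHermitian) {c : ℝ} (h : c • 1 ≤ A) :
    Real.exp c • 1 ≤ NormedSpace.exp A := by
  rw [← Algebra.algebraMap_eq_smul_one, algebraMap_le_iff_le_spectrum hA] at h
  rw [← Algebra.algebraMap_eq_smul_one, ← CFC.real_exp_eq_normedSpace_exp (a := A) hA]
  exact algebraMap_le_cfc _ _ _ (fun x hx => Real.exp_le_exp.mpr (h x hx))

/-- The largest eigenvalue of the positive operator `exp A` is at most its trace. This turns a bound
on the potential `Tr W_T` into an operator inequality. -/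
theorem le_smul_one_of_trace_exp_le {A : Matrix ι ι ℂ} (hA : A.IsHermitian) {c : ℝ}
    (h : (NormedSpace.exp A).trace.re ≤ Real.exp c) : A ≤ c • 1 := by
  have h1 : NormedSpace.exp A ≤ Real.exp c • 1 :=
    (le_trace_smul_one (exp_nonneg hA)).trans
      (smul_le_smul_of_nonneg_right h zero_le_one)
  rw [← Algebra.algebraMap_eq_smul_one, ← CFC.real_exp_eq_normedSpace_exp (a := A) hA] at h1
  have h2 := (cfc_le_algebraMap_iff Real.exp (Real.exp c) A (by fun_prop) hA).mp h1
  rw [← Algebra.algebraMap_eq_smul_one, le_algebraMap_iff_spectrum_le hA]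
  exact fun x hx => Real.exp_le_exp.mp (h2 x hx)

end Order

/-! ### Choi matrices and the maximum acceptance probability -/

section Choi

variable {M N : ℕ}

theorem partialTrace_apply (A : BiOp M N) (i j : Fin N) :
    partialTrace A i j = ∑ a : Fin M, A (a, i) (a, j) := rfl

theorem partialTrace_add (A B : BiOp M N) :
    partialTrace (A + B) = partialTrace A + partialTrace B := by
  ext i j
  simp [partialTrace_apply, Finset.sum_add_distrib]

theorem partialTrace_smul (r : ℝ) (A : BiOp M N) :
    partialTrace (r • A) = r • partialTrace A := by
  ext i j
  simp [partialTrace_apply, Finset.mul_sum]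

theorem partialTrace_isHermitian {A : BiOp M N} (hA : A.IsHermitian) :
    (partialTrace A).IsHermitian := by
  ext i j
  simp only [Matrix.conjTranspose_apply, partialTrace_apply, star_sum]
  exact Finset.sum_congr rfl fun a _ => hA.apply _ _

theorem partialTrace_one_kronecker (Y : Op N) :
    partialTrace ((1 : Op M) ⊗ₖ Y) = (M : ℝ) • Y := by
  ext i j
  simp [partialTrace_apply, Matrix.kroneckerMap_apply]

theorem trace_partialTrace (A : BiOp M N) : (partialTrace A).trace = A.trace := by
  simp only [Matrix.trace, Matrix.diag, partialTrace_apply, Fintype.sum_prod_type]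
  exact Finset.sum_comm

theorem partialTrace_mul_one_kronecker (A : BiOp M N) (Y : Op N) :
    partialTrace (A * ((1 : Op M) ⊗ₖ Y)) = partialTrace A * Y := by
  ext i j
  have h : ∀ a : Fin M, (A * ((1 : Op M) ⊗ₖ Y)) (a, i) (a, j) = ∑ k, A (a, i) (a, k) * Y k j := by
    intro a
    rw [Matrix.mul_apply, Fintype.sum_prod_type, Finset.sum_eq_single a]
    · simp [Matrix.kroneckerMap_apply]
    · intro b _ hb
      simp [Matrix.kroneckerMap_apply, hb]
    · simp
  rw [partialTrace_apply, Matrix.mul_apply]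
  simp only [h, partialTrace_apply, Finset.sum_mul]
  exact Finset.sum_comm

theorem partialTrace_one_kronecker_mul (A : BiOp M N) (Y : Op N) :
    partialTrace (((1 : Op M) ⊗ₖ Y) * A) = Y * partialTrace A := by
  ext i j
  have h : ∀ a : Fin M, (((1 : Op M) ⊗ₖ Y) * A) (a, i) (a, j) = ∑ k, Y i k * A (a, k) (a, j) := by
    intro a
    rw [Matrix.mul_apply, Fintype.sum_prod_type, Finset.sum_eq_single a]
    · simp [Matrix.kroneckerMap_apply]
    · intro b _ hb
      simp [Matrix.kroneckerMap_apply, hb.symm]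
    · simp
  rw [partialTrace_apply, Matrix.mul_apply]
  simp only [h, partialTrace_apply, Finset.mul_sum]
  exact Finset.sum_comm

theorem one_kronecker_nonneg {Y : Op N} (hY : 0 ≤ Y) : 0 ≤ (1 : Op M) ⊗ₖ Y :=
  Matrix.nonneg_iff_posSemidef.mpr
    (Matrix.PosSemidef.one.kronecker (Matrix.nonneg_iff_posSemidef.mp hY))

theorem one_kronecker_isHermitian {Y : Op N} (hY : Y.IsHermitian) :
    ((1 : Op M) ⊗ₖ Y).IsHermitian := by
  rw [Matrix.IsHermitian, Matrix.conjTranspose_kronecker, hY.eq, Matrix.conjTranspose_one]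

theorem choi_apply (Ψ : Op N →ₗ[ℂ] Op M) (a b : Fin M) (i j : Fin N) :
    choi Ψ (a, i) (b, j) = Ψ (Matrix.single i j 1) a b := by
  simp only [choi, Matrix.sum_apply, Matrix.kroneckerMap_apply, Matrix.single_apply]
  rw [Finset.sum_eq_single i (by intro k _ hk; simp [hk]) (by simp),
    Finset.sum_eq_single j (by intro k _ hk; simp [hk]) (by simp)]
  simp

theorem choi_nonneg {Ψ : Op N →ₗ[ℂ] Op M} (h : IsCompletelyPositive Ψ) : 0 ≤ choi Ψ := by
  -- The unnormalized maximally entangled vector: amplifying `Ψ` on its projection produces the Choi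
  -- matrix.
  let v : Fin N × Fin N → ℂ := fun p => if p.1 = p.2 then 1 else 0
  have h1 := h N (Matrix.vecMulVec v (star v)) (Matrix.posSemidef_vecMulVec_self_star v)
  have h2 : choi Ψ = ampliation Ψ N (Matrix.vecMulVec v (star v)) := by
    ext ⟨a, i⟩ ⟨b, j⟩
    have h3 : Matrix.single i j (1 : ℂ) =
        Matrix.of fun k l => Matrix.vecMulVec v (star v) (k, i) (l, j) := by
      ext k l
      simp only [Matrix.vecMulVec_apply, Matrix.of_apply, Matrix.single_apply, v, Pi.star_apply]
      by_cases hk : i = k <;> by_cases hl : j = l <;> simp [hk, hl, Ne.symm]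
    rw [choi_apply, h3]
    rfl
  rw [h2]
  exact Matrix.nonneg_iff_posSemidef.mpr h1

theorem partialTrace_choi {Ψ : Op N →ₗ[ℂ] Op M} (h : ∀ X : Op N, (Ψ X).trace = X.trace) :
    partialTrace (choi Ψ) = 1 := by
  ext i j
  simp only [partialTrace_apply, choi_apply]
  have := h (Matrix.single i j 1)
  rw [Matrix.trace] at this
  simp only [Matrix.diag] at this
  rw [this]
  by_cases hij : i = j
  · subst hij; simp
  · rw [Matrix.trace_single_eq_of_ne _ _ _ hij, Matrix.one_apply_ne hij]

/-- The super-operator with Choi–Jamiołkowski representation `J`. -/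
noncomputable def ofChoi (J : BiOp M N) : Op N →ₗ[ℂ] Op M where
  toFun X := Matrix.of fun a b => ∑ i, ∑ j, X i j * J (a, i) (b, j)
  map_add' X Y := by
    ext a b
    simp [add_mul, Finset.sum_add_distrib]
  map_smul' c X := by
    ext a b
    simp [mul_assoc, Finset.mul_sum]

theorem choi_ofChoi (J : BiOp M N) : choi (ofChoi J) = J := by
  ext ⟨a, i⟩ ⟨b, j⟩
  rw [choi_apply]
  simp only [ofChoi, LinearMap.coe_mk, AddHom.coe_mk, Matrix.of_apply, Matrix.single_apply]
  rw [Finset.sum_eq_single i (by intro k _ hk; simp [hk.symm]) (by simp),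
    Finset.sum_eq_single j (by intro k _ hk; simp [hk.symm]) (by simp)]
  simp

/-- Write `J = CᴴC` and `P = DᴴD`. Contracting `C` with `D` over the input index gives a matrix `G`
whose Gram matrix is the amplified output. -/
theorem ofChoi_isCompletelyPositive {J : BiOp M N} (hJ : 0 ≤ J) :
    IsCompletelyPositive (ofChoi J) := by
  intro k P hP
  obtain ⟨C, hC⟩ := CStarAlgebra.nonneg_iff_eq_star_mul_self.mp hJ
  obtain ⟨D, hD⟩ := CStarAlgebra.nonneg_iff_eq_star_mul_self.mp
    (Matrix.nonneg_iff_posSemidef.mpr hP)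
  let G : Matrix ((Fin M × Fin N) × (Fin N × Fin k)) (Fin M × Fin k) ℂ :=
    Matrix.of fun c p => ∑ i, C c.1 (p.1, i) * D c.2 (i, p.2)
  have h : ampliation (ofChoi J) k P = Gᴴ * G := by
    ext ⟨a, z⟩ ⟨b, w⟩
    have hJ' : ∀ p q, J p q = ∑ c, star (C c p) * C c q := fun p q => by
      rw [hC, Matrix.mul_apply]; rfl
    have hP' : ∀ p q, P p q = ∑ d, star (D d p) * D d q := fun p q => by
      rw [hD, Matrix.mul_apply]; rfl
    simp only [ampliation, ofChoi, LinearMap.coe_mk, AddHom.coe_mk, Matrix.of_apply,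
      Matrix.mul_apply, Matrix.conjTranspose_apply, G, star_sum, star_mul', hJ', hP']
    simp only [Finset.sum_mul_sum]
    conv_rhs => rw [Finset.sum_comm]
    refine Finset.sum_congr rfl fun i _ => ?_
    conv_rhs => rw [Finset.sum_comm]
    refine Finset.sum_congr rfl fun j _ => ?_
    conv_rhs => rw [Fintype.sum_prod_type, Finset.sum_comm]
    refine Finset.sum_congr rfl fun d _ => Finset.sum_congr rfl fun c _ => ?_
    ring
  rw [h]
  exact Matrix.posSemidef_conjTranspose_mul_self G

theorem ofChoi_isQuantumOperation {J : BiOp M N} (hJ : 0 ≤ J) (hT : partialTrace J = 1) :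
    IsQuantumOperation (ofChoi J) := by
  refine ⟨ofChoi_isCompletelyPositive hJ, fun X => ?_⟩
  have h : ∀ i j, ∑ a : Fin M, J (a, i) (a, j) = (1 : Op N) i j := fun i j => by
    rw [← hT]; rfl
  simp only [Matrix.trace, Matrix.diag, ofChoi, LinearMap.coe_mk, AddHom.coe_mk, Matrix.of_apply]
  rw [Finset.sum_comm]
  refine Finset.sum_congr rfl fun i _ => ?_
  rw [Finset.sum_comm]
  simp only [← Finset.mul_sum, h, Matrix.one_apply]
  simp

theorem acceptanceValues_eq_image (Q : BiOp M N) :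
    acceptanceValues Q = hsInner Q '' {J | 0 ≤ J ∧ partialTrace J = 1} := by
  ext r
  constructor
  · rintro ⟨Ψ, ⟨h1, h2⟩, rfl⟩
    exact ⟨choi Ψ, ⟨choi_nonneg h1, partialTrace_choi h2⟩, rfl⟩
  · rintro ⟨J, ⟨h1, h2⟩, rfl⟩
    exact ⟨ofChoi J, ofChoi_isQuantumOperation h1 h2, by rw [choi_ofChoi]⟩

theorem trace_re_of_partialTrace_eq_one {J : BiOp M N} (h : partialTrace J = 1) :
    J.trace.re = N := by
  rw [← trace_partialTrace, h, trace_one_re, Fintype.card_fin]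

theorem isCompact_choi_set : IsCompact {J : BiOp M N | 0 ≤ J ∧ partialTrace J = 1} := by
  have : ProperSpace (BiOp M N) := FiniteDimensional.proper ℂ _
  refine Metric.isCompact_of_isClosed_isBounded ?_ ?_
  · refine (CStarAlgebra.isClosed_nonneg (A := BiOp M N)).inter
      (isClosed_eq ?_ continuous_const)
    refine continuous_matrix fun i j => ?_
    simp only [partialTrace_apply]
    exact continuous_finsetSum _ fun a _ => continuous_id.matrix_elem _ _
  · refine (Metric.isBounded_closedBall (x := (0 : BiOp M N)) (r := N)).subset ?_
    rintro J ⟨h1, h2⟩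
    rw [mem_closedBall_zero_iff, ← trace_re_of_partialTrace_eq_one h2]
    exact norm_le_trace_re h1

theorem choi_set_nonempty (hM : 0 < M) : {J : BiOp M N | 0 ≤ J ∧ partialTrace J = 1}.Nonempty := by
  refine ⟨(M : ℝ)⁻¹ • ((1 : Op M) ⊗ₖ (1 : Op N)),
    smul_nonneg (by positivity) (one_kronecker_nonneg zero_le_one), ?_⟩
  have : (M : ℝ) ≠ 0 := by positivity
  rw [partialTrace_smul, partialTrace_one_kronecker, smul_smul, inv_mul_cancel₀ this, one_smul]

theorem isGreatest_mu (hM : 0 < M) (Q : BiOp M N) : IsGreatest (acceptanceValues Q) (mu Q) := by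
  have hc : Continuous (hsInner Q) := by
    unfold hsInner
    fun_prop
  rw [mu, acceptanceValues_eq_image]
  exact (isCompact_choi_set.image hc).isGreatest_sSup ((choi_set_nonempty hM).image _)

theorem exists_choi_eq_mu (hM : 0 < M) (Q : BiOp M N) :
    ∃ J : BiOp M N, 0 ≤ J ∧ partialTrace J = 1 ∧ hsInner Q J = mu Q := by
  have h := (isGreatest_mu hM Q).1
  rw [acceptanceValues_eq_image] at h
  obtain ⟨J, ⟨h1, h2⟩, h3⟩ := h
  exact ⟨J, h1, h2, h3⟩

theorem hsInner_le_mu (hM : 0 < M) (Q : BiOp M N) {J : BiOp M N} (h1 : 0 ≤ J)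
    (h2 : partialTrace J = 1) : hsInner Q J ≤ mu Q := by
  refine (isGreatest_mu hM Q).2 ?_
  rw [acceptanceValues_eq_image]
  exact ⟨J, ⟨h1, h2⟩, rfl⟩

theorem hsInner_of_isHermitian {ι : Type} [Fintype ι] {A : Matrix ι ι ℂ} (hA : A.IsHermitian)
    (B : Matrix ι ι ℂ) : hsInner A B = (A * B).trace.re := by
  rw [hsInner, hA.eq]

/-- Test `R` on a Choi matrix optimal for `Q`. All competing Choi matrices have trace `N`, whence
the factor `N`. -/
theorem mu_sub_mu_le (hM : 0 < M) {Q R : BiOp M N} (hQ : Q.IsHermitian) (hR : R.IsHermitian) :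
    mu Q - mu R ≤ N * ‖Q - R‖ := by
  obtain ⟨J, h1, h2, h3⟩ := exists_choi_eq_mu hM Q
  have h4 := hsInner_le_mu hM R h1 h2
  rw [← h3]
  have h5 := abs_trace_mul_re_le (hQ.sub hR) h1
  rw [sub_mul, Matrix.trace_sub, Complex.sub_re, trace_re_of_partialTrace_eq_one h2] at h5
  rw [hsInner_of_isHermitian hQ]
  rw [hsInner_of_isHermitian hR] at h4
  linarith [le_abs_self ((Q * J).trace.re - (R * J).trace.re)]

theorem abs_mu_sub_mu_le (hM : 0 < M) {Q R : BiOp M N} (hQ : Q.IsHermitian) (hR : R.IsHermitian) :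
    |mu Q - mu R| ≤ N * ‖Q - R‖ := by
  rw [abs_le]
  have h1 := mu_sub_mu_le hM hQ hR
  have h2 := mu_sub_mu_le hM hR hQ
  rw [norm_sub_rev] at h2
  exact ⟨by linarith, h1⟩

end Choi

/-! ### The semidefinite program and weak duality -/

section Program

variable {M N : ℕ} {Q : BiOp M N}

theorem isUnit_sqrt (hQ : 0 ≤ Q) (hU : IsUnit Q) : IsUnit (CFC.sqrt Q) :=
  (CFC.isUnit_sqrt_iff Q hQ).mpr hU

theorem sqrt_mul_invSqrt (hQ : 0 ≤ Q) (hU : IsUnit Q) : CFC.sqrt Q * invSqrt Q = 1 :=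
  Matrix.mul_nonsing_inv _ ((Matrix.isUnit_iff_isUnit_det _).mp (isUnit_sqrt hQ hU))

theorem invSqrt_mul_sqrt (hQ : 0 ≤ Q) (hU : IsUnit Q) : invSqrt Q * CFC.sqrt Q = 1 :=
  Matrix.nonsing_inv_mul _ ((Matrix.isUnit_iff_isUnit_det _).mp (isUnit_sqrt hQ hU))

theorem sqrt_isHermitian (Q : BiOp M N) : (CFC.sqrt Q).IsHermitian :=
  isHermitian_of_nonneg (CFC.sqrt_nonneg Q)

theorem invSqrt_isHermitian (Q : BiOp M N) : (invSqrt Q).IsHermitian :=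
  (sqrt_isHermitian Q).inv

theorem invSqrt_mul_invSqrt (hQ : 0 ≤ Q) : invSqrt Q * invSqrt Q = Q⁻¹ := by
  rw [invSqrt, ← Matrix.mul_inv_rev, CFC.sqrt_mul_sqrt_self Q hQ]

theorem invSqrt_mul_mul_invSqrt (hQ : 0 ≤ Q) (hU : IsUnit Q) :
    invSqrt Q * Q * invSqrt Q = 1 := by
  have h : invSqrt Q * Q * invSqrt Q = invSqrt Q * (CFC.sqrt Q * CFC.sqrt Q) * invSqrt Q := by
    rw [CFC.sqrt_mul_sqrt_self Q hQ]
  rw [h, ← mul_assoc, invSqrt_mul_sqrt hQ hU, one_mul, sqrt_mul_invSqrt hQ hU]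

theorem invSqrt_conj_mono (Q : BiOp M N) {A B : BiOp M N} (h : A ≤ B) :
    invSqrt Q * A * invSqrt Q ≤ invSqrt Q * B * invSqrt Q := by
  have := conjTranspose_mul_mul_le h (invSqrt Q)
  rwa [(invSqrt_isHermitian Q).eq] at this

theorem invSqrt_conj_nonneg (Q : BiOp M N) {A : BiOp M N} (h : 0 ≤ A) :
    0 ≤ invSqrt Q * A * invSqrt Q := by
  simpa using invSqrt_conj_mono Q h

theorem invSqrt_conj_isHermitian (Q : BiOp M N) {A : BiOp M N} (h : A.IsHermitian) :
    (invSqrt Q * A * invSqrt Q).IsHermitian := by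
  have := Matrix.isHermitian_conjTranspose_mul_mul (invSqrt Q) h
  rwa [(invSqrt_isHermitian Q).eq] at this

theorem sqrt_conj_nonneg (Q : BiOp M N) {A : BiOp M N} (h : 0 ≤ A) :
    0 ≤ CFC.sqrt Q * A * CFC.sqrt Q := by
  have := conjTranspose_mul_mul_le h (CFC.sqrt Q)
  rw [(sqrt_isHermitian Q).eq] at this
  simpa using this

theorem Phi_isHermitian (Q : BiOp M N) {X : BiOp M N} (h : X.IsHermitian) :
    (Phi Q X).IsHermitian :=
  partialTrace_isHermitian (invSqrt_conj_isHermitian Q h)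

theorem PhiStar_nonneg (Q : BiOp M N) {Y : Op N} (h : 0 ≤ Y) : 0 ≤ PhiStar Q Y :=
  invSqrt_conj_nonneg Q (one_kronecker_nonneg h)

theorem PhiStar_isHermitian (Q : BiOp M N) {Y : Op N} (h : Y.IsHermitian) :
    (PhiStar Q Y).IsHermitian :=
  invSqrt_conj_isHermitian Q (one_kronecker_isHermitian h)

theorem PhiStar_add (Q : BiOp M N) (Y Y' : Op N) :
    PhiStar Q (Y + Y') = PhiStar Q Y + PhiStar Q Y' := by
  simp only [PhiStar, Matrix.kronecker_add, mul_add, add_mul]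

theorem PhiStar_sub (Q : BiOp M N) (Y Y' : Op N) :
    PhiStar Q (Y - Y') = PhiStar Q Y - PhiStar Q Y' := by
  rw [eq_sub_iff_add_eq, ← PhiStar_add, sub_add_cancel]

theorem PhiStar_smul (Q : BiOp M N) (r : ℝ) (Y : Op N) :
    PhiStar Q (r • Y) = r • PhiStar Q Y := by
  simp only [PhiStar, Matrix.kronecker_smul, Matrix.mul_smul, Matrix.smul_mul]

theorem PhiStar_zero (Q : BiOp M N) : PhiStar Q 0 = 0 := by
  simp [PhiStar]

theorem PhiStar_one (hQ : 0 ≤ Q) : PhiStar Q 1 = Q⁻¹ := by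
  rw [PhiStar, Matrix.one_kronecker_one, mul_one, invSqrt_mul_invSqrt hQ]

theorem inv_isHermitian (hQ : 0 ≤ Q) : Q⁻¹.IsHermitian := (isHermitian_of_nonneg hQ).inv

theorem PhiStar_le_smul_one (hQ : 0 ≤ Q) {Y : Op N} {c : ℝ} (hc : 0 ≤ c) (h : Y ≤ c • 1) :
    PhiStar Q Y ≤ (c * ‖Q⁻¹‖) • 1 := by
  have h1 := PhiStar_nonneg Q (sub_nonneg.mpr h)
  rw [PhiStar_sub, sub_nonneg, PhiStar_smul, PhiStar_one hQ] at h1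
  refine h1.trans ?_
  rw [mul_smul]
  exact smul_le_smul_of_nonneg_left (le_norm_smul_one (inv_isHermitian hQ)) hc

theorem trace_Phi_mul (Q X : BiOp M N) (Y : Op N) :
    (Phi Q X * Y).trace = (X * PhiStar Q Y).trace := by
  rw [Phi, ← partialTrace_mul_one_kronecker, trace_partialTrace, PhiStar, mul_assoc, mul_assoc,
    Matrix.trace_mul_comm]
  simp only [mul_assoc]

theorem trace_mul_invSqrt_conj (hQ : 0 ≤ Q) (hU : IsUnit Q) (X : BiOp M N) :
    (Q * (invSqrt Q * X * invSqrt Q)).trace = X.trace := by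
  rw [mul_assoc, ← mul_assoc Q, Matrix.trace_mul_comm, mul_assoc, ← mul_assoc _ Q,
    invSqrt_mul_mul_invSqrt hQ hU, mul_one]

/-- Weak duality for primal feasible operators. -/
theorem trace_le_mu_of_primalFeasible (hM : 0 < M) (hQ : 0 ≤ Q) (hU : IsUnit Q) {X : BiOp M N}
    (hX : PrimalFeasible Q X) : X.trace.re ≤ mu Q := by
  set J₀ := invSqrt Q * X * invSqrt Q with hJ₀
  have h0 : 0 ≤ J₀ := invSqrt_conj_nonneg Q hX.1
  have hc : 0 ≤ 1 - partialTrace J₀ := sub_nonneg.mpr hX.2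
  have hM' : (M : ℝ) ≠ 0 := by positivity
  have hK : 0 ≤ (M : ℝ)⁻¹ • ((1 : Op M) ⊗ₖ (1 - partialTrace J₀)) :=
    smul_nonneg (by positivity) (one_kronecker_nonneg hc)
  -- `J₀` only satisfies `Tr_𝒴 J₀ ≤ 1`. Padding by the deficit, spread evenly over `𝒴`, yields a
  -- Choi matrix, and `Q ≥ 0` means that the value does not drop.
  have h1 := hsInner_le_mu hM Q (J := J₀ + (M : ℝ)⁻¹ • ((1 : Op M) ⊗ₖ (1 - partialTrace J₀)))
    (add_nonneg h0 hK) (by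
      rw [partialTrace_add, partialTrace_smul, partialTrace_one_kronecker, smul_smul,
        inv_mul_cancel₀ hM', one_smul, add_sub_cancel])
  rw [hsInner_of_isHermitian (isHermitian_of_nonneg hQ), mul_add, Matrix.trace_add,
    Complex.add_re] at h1
  have h2 := trace_mul_re_nonneg hQ hK
  rw [hJ₀, trace_mul_invSqrt_conj hQ hU] at h1
  linarith

theorem le_one_kronecker_of_dualFeasible (hQ : 0 ≤ Q) (hU : IsUnit Q) {Y : Op N}
    (hY : DualFeasible Q Y) : Q ≤ (1 : Op M) ⊗ₖ Y := by
  have h := conjTranspose_mul_mul_le hY.2 (CFC.sqrt Q)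
  have h2 : CFC.sqrt Q * PhiStar Q Y * CFC.sqrt Q = (1 : Op M) ⊗ₖ Y := by
    rw [PhiStar, mul_assoc, mul_assoc, invSqrt_mul_sqrt hQ hU, mul_one, ← mul_assoc,
      sqrt_mul_invSqrt hQ hU, one_mul]
  rwa [(sqrt_isHermitian Q).eq, mul_one, CFC.sqrt_mul_sqrt_self Q hQ, h2] at h

/-- Weak duality for dual feasible operators. -/
theorem mu_le_trace_of_dualFeasible (hM : 0 < M) (hQ : 0 ≤ Q) (hU : IsUnit Q) {Y : Op N}
    (hY : DualFeasible Q Y) : mu Q ≤ Y.trace.re := by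
  obtain ⟨J, h1, h2, h3⟩ := exists_choi_eq_mu hM Q
  have h4 := trace_mul_re_mono (le_one_kronecker_of_dualFeasible hQ hU hY) h1
  rwa [← hsInner_of_isHermitian (isHermitian_of_nonneg hQ), h3, ← trace_partialTrace,
    partialTrace_one_kronecker_mul, h2, mul_one] at h4

theorem dualFeasible_of_le (hQ : 0 ≤ Q) (hU : IsUnit Q) {Y : Op N} (hY : 0 ≤ Y)
    (h : Q ≤ (1 : Op M) ⊗ₖ Y) : DualFeasible Q Y := by
  refine ⟨hY, ?_⟩
  have := invSqrt_conj_mono Q h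
  rwa [invSqrt_mul_mul_invSqrt hQ hU] at this

/-- Since `Π ≤ 1`, `Q` is dominated by `1 ⊗ B*B`, and `Tr B*B = ‖ψ‖² = 1`. This provides a dual
feasible operator of trace `1` and the bound `‖Q‖ ≤ 1`. -/
theorem IsInteractiveMeasurement.nonneg_and_exists_le (hQ : IsInteractiveMeasurement Q) :
    0 ≤ Q ∧ ∃ Y : Op N, 0 ≤ Y ∧ Y.trace.re = 1 ∧ Q ≤ (1 : Op M) ⊗ₖ Y := by
  obtain ⟨k, ψ, P, hψ, hP0, hP1, rfl⟩ := hQ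
  set B : Matrix (Fin k) (Fin N) ℂ := Matrix.of fun z i => ψ (i, z) with hB
  have hH : (1 : Op M) ⊗ₖ Bᴴ = ((1 : Op M) ⊗ₖ B)ᴴ := by
    rw [Matrix.conjTranspose_kronecker, Matrix.conjTranspose_one]
  rw [hH]
  refine ⟨by simpa using conjTranspose_mul_mul_le hP0 ((1 : Op M) ⊗ₖ B), Bᴴ * B,
    Matrix.nonneg_iff_posSemidef.mpr (Matrix.posSemidef_conjTranspose_mul_self B), ?_, ?_⟩
  · rw [Fintype.sum_prod_type] at hψ
    simp only [Matrix.trace, Matrix.diag, Matrix.mul_apply, Matrix.conjTranspose_apply,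
      Complex.re_sum, hB, Matrix.of_apply]
    rw [← hψ]
    refine Finset.sum_congr rfl fun i _ => Finset.sum_congr rfl fun z _ => ?_
    rw [Complex.star_def, Complex.conj_mul', ← Complex.ofReal_pow, Complex.ofReal_re]
  · have h := conjTranspose_mul_mul_le hP1 ((1 : Op M) ⊗ₖ B)
    rwa [Matrix.mul_one, ← hH, ← Matrix.mul_kronecker_mul, one_mul, hH] at h

theorem IsInteractiveMeasurement.nonneg (hQ : IsInteractiveMeasurement Q) : 0 ≤ Q :=
  hQ.nonneg_and_exists_le.1

theorem IsInteractiveMeasurement.exists_dualFeasible (hQ : IsInteractiveMeasurement Q)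
    (hU : IsUnit Q) : ∃ Y : Op N, DualFeasible Q Y ∧ Y.trace.re = 1 := by
  obtain ⟨h0, Y, h1, h2, h3⟩ := hQ.nonneg_and_exists_le
  exact ⟨Y, dualFeasible_of_le h0 hU h1 h3, h2⟩

theorem IsInteractiveMeasurement.norm_le_one (hQ : IsInteractiveMeasurement Q) : ‖Q‖ ≤ 1 := by
  obtain ⟨h0, Y, h1, h2, h3⟩ := hQ.nonneg_and_exists_le
  refine norm_le_of_le_smul_one h0 zero_le_one (h3.trans ?_)
  have h4 : Y ≤ 1 := by simpa [h2] using le_trace_smul_one h1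
  have h5 := one_kronecker_nonneg (M := M) (sub_nonneg.mpr h4)
  have h6 : (1 : Op M) ⊗ₖ (1 - Y) = 1 - (1 : Op M) ⊗ₖ Y := by
    rw [eq_sub_iff_add_eq, ← Matrix.kronecker_add, sub_add_cancel, Matrix.one_kronecker_one]
  rw [h6, sub_nonneg] at h5
  rwa [one_smul]

theorem one_le_kappa (hM : 0 < M) (hN : 0 < N) (hU : IsUnit Q) : 1 ≤ kappa Q := by
  have : Nonempty (Fin M × Fin N) := ⟨(⟨0, hM⟩, ⟨0, hN⟩)⟩
  have h : Q * Q⁻¹ = 1 := Matrix.mul_nonsing_inv _ ((Matrix.isUnit_iff_isUnit_det _).mp hU)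
  have h2 := norm_mul_le Q Q⁻¹
  rwa [h, CStarRing.norm_one] at h2

theorem IsInteractiveMeasurement.one_le_norm_inv (hM : 0 < M) (hN : 0 < N)
    (hQ : IsInteractiveMeasurement Q) (hU : IsUnit Q) : 1 ≤ ‖Q⁻¹‖ :=
  (one_le_kappa hM hN hU).trans
    (mul_le_of_le_one_left (norm_nonneg _) hQ.norm_le_one)

theorem delta_pos (hM : 0 < M) (hN : 0 < N) (hU : IsUnit Q) {ε : ℝ} (hε : 0 < ε) :
    0 < delta Q ε := by
  have := one_le_kappa hM hN hU
  rw [delta]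
  positivity

end Program

/-! ### Spectral decompositions and the operators `Y_t` -/

section Spectral

variable {M N : ℕ}

/-- The operator with eigenvalue `f j` on the `j`-th column of `U`. -/
noncomputable def specOp (U : Matrix.unitaryGroup (Fin N) ℂ) (f : Fin N → ℝ) : Op N :=
  (U : Op N) * Matrix.diagonal (fun j => (f j : ℂ)) * (U : Op N)ᴴ

variable (U : Matrix.unitaryGroup (Fin N) ℂ)

theorem conjTranspose_unitary_mul_self : (U : Op N)ᴴ * (U : Op N) = 1 :=
  Matrix.mem_unitaryGroup_iff'.mp U.2

theorem unitary_mul_conjTranspose_self : (U : Op N) * (U : Op N)ᴴ = 1 :=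
  Matrix.mem_unitaryGroup_iff.mp U.2

theorem specOp_mul (f g : Fin N → ℝ) :
    specOp U f * specOp U g = specOp U (fun j => f j * g j) := by
  have h : specOp U f * specOp U g = (U : Op N) * Matrix.diagonal (fun j => (f j : ℂ)) *
      ((U : Op N)ᴴ * (U : Op N)) * Matrix.diagonal (fun j => (g j : ℂ)) * (U : Op N)ᴴ := by
    simp only [specOp, mul_assoc]
  rw [h, conjTranspose_unitary_mul_self, mul_one, mul_assoc (U : Op N),
    Matrix.diagonal_mul_diagonal]
  simp only [specOp, Complex.ofReal_mul]

theorem specOp_add (f g : Fin N → ℝ) :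
    specOp U f + specOp U g = specOp U (fun j => f j + g j) := by
  simp only [specOp, ← add_mul, ← mul_add, Matrix.diagonal_add, Complex.ofReal_add]

theorem specOp_smul (r : ℝ) (f : Fin N → ℝ) :
    r • specOp U f = specOp U (fun j => r * f j) := by
  have h : Matrix.diagonal (fun j => ((r * f j : ℝ) : ℂ)) =
      r • Matrix.diagonal (fun j => (f j : ℂ)) := by
    rw [← Matrix.diagonal_smul]
    congr 1
    ext j
    simp
  simp only [specOp, h, Matrix.mul_smul, Matrix.smul_mul]

theorem specOp_const_one : specOp U (fun _ => 1) = 1 := by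
  simp [specOp, unitary_mul_conjTranspose_self]

theorem specOp_const (r : ℝ) : specOp U (fun _ => r) = r • 1 := by
  rw [← specOp_const_one U, specOp_smul]
  simp

theorem specOp_isHermitian (f : Fin N → ℝ) : (specOp U f).IsHermitian := by
  rw [Matrix.IsHermitian, specOp, Matrix.conjTranspose_mul, Matrix.conjTranspose_mul,
    Matrix.conjTranspose_conjTranspose, Matrix.diagonal_conjTranspose, mul_assoc]
  congr 3
  ext j
  simp

theorem specOp_nonneg {f : Fin N → ℝ} (h : ∀ j, 0 ≤ f j) : 0 ≤ specOp U f := by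
  refine Matrix.nonneg_iff_posSemidef.mpr (Matrix.PosSemidef.mul_mul_conjTranspose_same
    (Matrix.PosSemidef.diagonal fun j => ?_) _)
  simpa using h j

theorem specOp_mono {f g : Fin N → ℝ} (h : ∀ j, f j ≤ g j) : specOp U f ≤ specOp U g := by
  have h1 := specOp_nonneg U (f := fun j => g j - f j) fun j => sub_nonneg.mpr (h j)
  have h2 : specOp U g = specOp U f + specOp U (fun j => g j - f j) := by
    rw [specOp_add]; simp
  rw [h2]
  exact le_add_of_nonneg_right h1

theorem specOp_trace_re (f : Fin N → ℝ) : (specOp U f).trace.re = ∑ j, f j := by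
  rw [specOp, Matrix.trace_mul_comm, ← mul_assoc, conjTranspose_unitary_mul_self, one_mul,
    Matrix.trace_diagonal]
  simp

theorem sum_ketbra (r : Record M N) (f : Fin N → ℝ) :
    ∑ j, (f j : ℂ) • r.ketbra j = specOp r.U f := by
  ext a b
  rw [specOp, Matrix.mul_apply]
  simp only [Matrix.sum_apply, Matrix.smul_apply, Record.ketbra, Matrix.vecMulVec_apply,
    Matrix.mul_diagonal, Matrix.conjTranspose_apply, Pi.star_apply,
    smul_eq_mul]
  exact Finset.sum_congr rfl fun j _ => by ring

theorem Record.decomp_eq (r : Record M N) : r.decomp = specOp r.U r.lam := sum_ketbra r r.lam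

variable (γ : ℝ)

theorem Record.mem_bigS (r : Record M N) (j : Fin N) : j ∈ r.bigS γ ↔ 1 < γ * r.lam j := by
  simp [Record.bigS]

theorem Record.smallS_eq (r : Record M N) :
    r.smallS γ = ∑ j, if j ∈ r.bigS γ then r.lam j else 0 := by
  rw [Record.smallS, Finset.sum_ite_mem, Finset.univ_inter]

theorem Record.Y_eq (r : Record M N) :
    r.Y γ = specOp r.U (fun j => if j ∈ r.bigS γ then 1 / r.smallS γ else 0) := by
  rw [← sum_ketbra, Record.Y, Finset.smul_sum, ← Finset.univ_inter (r.bigS γ),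
    ← Finset.sum_ite_mem]
  refine Finset.sum_congr rfl fun j _ => ?_
  rw [Finset.univ_inter]
  split_ifs <;> simp

theorem Record.Y_isHermitian (r : Record M N) : (r.Y γ).IsHermitian := by
  rw [Record.Y_eq]
  exact specOp_isHermitian _ _

variable {γ} {r : Record M N}

theorem Record.Y_nonneg (hs : 0 < r.smallS γ) : 0 ≤ r.Y γ := by
  rw [Record.Y_eq]
  refine specOp_nonneg _ fun j => ?_
  split_ifs
  · positivity
  · exact le_rfl

theorem Record.Y_le (hs : 0 < r.smallS γ) : r.Y γ ≤ (1 / r.smallS γ) • 1 := by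
  rw [Record.Y_eq, ← specOp_const r.U]
  refine specOp_mono _ fun j => ?_
  split_ifs
  · exact le_rfl
  · positivity

/-- Each `j ∈ S` satisfies `1 < γ λ_j`, so `|S| ≤ γ s`, and `Tr Y = |S| / s`. -/
theorem Record.trace_Y_le (hγ : 0 < γ) (hs : 0 < r.smallS γ) : (r.Y γ).trace.re ≤ γ := by
  rw [Record.Y_eq, specOp_trace_re]
  have h1 : ∀ j, (if j ∈ r.bigS γ then 1 / r.smallS γ else 0) ≤
      γ / r.smallS γ * (if j ∈ r.bigS γ then r.lam j else 0) := by
    intro j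
    split_ifs with hj
    · rw [Record.mem_bigS] at hj
      rw [div_mul_eq_mul_div]
      gcongr
    · simp
  refine (Finset.sum_le_sum fun j _ => h1 j).trans (le_of_eq ?_)
  rw [← Finset.mul_sum, ← Record.smallS_eq]
  field_simp

theorem Record.trace_decomp_mul_Y (hs : 0 < r.smallS γ) :
    (r.decomp * r.Y γ).trace.re = 1 := by
  rw [Record.Y_eq, Record.decomp_eq, specOp_mul, specOp_trace_re]
  have h1 : ∀ j, r.lam j * (if j ∈ r.bigS γ then 1 / r.smallS γ else 0) =
      (1 / r.smallS γ) * (if j ∈ r.bigS γ then r.lam j else 0) := by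
    intro j
    split_ifs <;> ring
  simp only [h1]
  rw [← Finset.mul_sum, ← Record.smallS_eq]
  field_simp

end Spectral

/-! ### Primal certificates from small spectral weight -/

section Accept

variable {M N : ℕ} {Q : BiOp M N} {γ : ℝ} {r : Record M N}

/-- Cauchy–Schwarz in disguise: nonnegativity of the squared norm of `x G - B` gives `Re ⟨B, G⟩ ≤
x`. Expanding the squared norm of `G - B` then costs at most `2 x`. -/
theorem one_sub_two_mul_le_trace {ι : Type*} [Fintype ι] {G B : Matrix ι ι ℂ} {x : ℝ} (hx : 0 < x)
    (hG : (G * Gᴴ).trace.re = 1) (hB : (B * Bᴴ).trace.re ≤ x ^ 2) :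
    1 - 2 * x ≤ ((G - B) * (G - B)ᴴ).trace.re := by
  have h1 := trace_mul_conjTranspose_re_nonneg (x • G - B)
  have h2 : (B * Gᴴ).trace.re = (G * Bᴴ).trace.re := by
    rw [← trace_conjTranspose_re, Matrix.conjTranspose_mul, Matrix.conjTranspose_conjTranspose]
  simp only [Matrix.conjTranspose_sub, Matrix.conjTranspose_smul, star_trivial, sub_mul, mul_sub,
    Matrix.trace_sub, Complex.sub_re, h2, Matrix.smul_mul, Matrix.mul_smul, trace_real_smul_re,
    hG] at h1 ⊢
  have h3 : 2 * x * (G * Bᴴ).trace.re ≤ 2 * x * x := by nlinarith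
  have h4 : (G * Bᴴ).trace.re ≤ x := le_of_mul_le_mul_left h3 (by positivity)
  have h5 := trace_mul_conjTranspose_re_nonneg B
  linarith

theorem trace_mul_decomp_le (hρ : IsDensity r.rho) {h : ℝ} (hh : 0 ≤ h)
    (herr : ‖Phi Q r.rho - r.decomp‖ ≤ h) :
    (Phi Q r.rho * specOp r.U (fun j => if j ∈ r.bigS γ then 1 else 0)).trace.re ≤
      r.smallS γ + N * h := by
  have hH : (Phi Q r.rho - r.decomp).IsHermitian :=
    (Phi_isHermitian Q hρ.1.isHermitian).sub (by rw [Record.decomp_eq]; exact specOp_isHermitian _ _)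
  have hP : 0 ≤ specOp r.U (fun j => if j ∈ r.bigS γ then 1 else 0) :=
    specOp_nonneg _ fun j => by split_ifs <;> simp
  have h1 := (le_abs_self _).trans (abs_trace_mul_re_le hH hP)
  rw [sub_mul, Matrix.trace_sub, Complex.sub_re, specOp_trace_re, Record.decomp_eq, specOp_mul,
    specOp_trace_re] at h1
  simp only [mul_ite, mul_one, mul_zero] at h1
  rw [← Record.smallS_eq, ← Record.decomp_eq] at h1
  have h2 : (∑ j, if j ∈ r.bigS γ then (1 : ℝ) else 0) ≤ N := by
    calc _ ≤ ∑ _j : Fin N, (1 : ℝ) := Finset.sum_le_sum fun j _ => by split_ifs <;> simp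
      _ = N := by simp
  have h3 : ‖Phi Q r.rho - r.decomp‖ * (∑ j, if j ∈ r.bigS γ then (1 : ℝ) else 0) ≤ h * N :=
    mul_le_mul herr h2 (Finset.sum_nonneg fun j _ => by split_ifs <;> simp) hh
  linarith

/-- The operator `ρ` equals `Q^{1/2} Z Q^{1/2}` with `Z = Q^{-1/2} ρ Q^{-1/2}`. Compressing `Z` by
`1 ⊗ P`, with `P` the projection onto the eigenvectors outside `S`, replaces `Φ(ρ)` by `P Φ(ρ) P`,
which is at most `1/γ + h`. Here `h` bounds the decomposition error, and `x` measures the amplitude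
removed. -/
theorem exists_primalFeasible_of_decomp (hQ : 0 ≤ Q) (hU : IsUnit Q) (hγ : 0 < γ)
    (hρ : IsDensity r.rho) {h x : ℝ} (hh : 0 ≤ h) (hx : 0 < x)
    (herr : ‖Phi Q r.rho - r.decomp‖ ≤ h) (hs : ‖Q‖ * (r.smallS γ + N * h) ≤ x ^ 2) :
    ∃ X : BiOp M N, PrimalFeasible Q X ∧ γ * (1 - 2 * x) ≤ X.trace.re * (1 + γ * h) := by
  set P : Op N := specOp r.U (fun j => if j ∈ r.bigS γ then 0 else 1) with hP
  set S : Op N := specOp r.U (fun j => if j ∈ r.bigS γ then 1 else 0) with hS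
  have hPS : P = 1 - S := by
    rw [eq_sub_iff_add_eq, hP, hS, specOp_add, ← specOp_const_one r.U]
    congr 1
    ext j
    split_ifs <;> simp
  have hPH : P.IsHermitian := specOp_isHermitian _ _
  have hSH : S.IsHermitian := specOp_isHermitian _ _
  have hSS : S * S = S := by
    rw [hS, specOp_mul]
    congr 1
    ext j
    split_ifs <;> simp
  have hρ0 : 0 ≤ r.rho := Matrix.nonneg_iff_posSemidef.mpr hρ.1
  set Z := invSqrt Q * r.rho * invSqrt Q with hZ
  have hZ0 : 0 ≤ Z := invSqrt_conj_nonneg Q hρ0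
  set R := CFC.sqrt Q with hR
  have hRH : R.IsHermitian := sqrt_isHermitian Q
  have hRR : R * R = Q := CFC.sqrt_mul_sqrt_self Q hQ
  set P' := (1 : Op M) ⊗ₖ P with hP'
  set S' := (1 : Op M) ⊗ₖ S with hS'
  have hP'H : P'.IsHermitian := one_kronecker_isHermitian hPH
  have hS'H : S'.IsHermitian := one_kronecker_isHermitian hSH
  have hPS' : P' = 1 - S' := by
    rw [eq_sub_iff_add_eq, hP', hS', ← Matrix.kronecker_add, hPS, sub_add_cancel,
      Matrix.one_kronecker_one]
  have hK0 : 0 ≤ P' * Z * P' := by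
    have := conjTranspose_mul_mul_le hZ0 P'
    rw [hP'H.eq] at this
    simpa using this
  have hPhi : partialTrace (P' * Z * P') = P * Phi Q r.rho * P := by
    rw [hP', partialTrace_mul_one_kronecker, partialTrace_one_kronecker_mul]
    rfl
  set c := γ / (1 + γ * h) with hc
  -- The scale `c` is the reciprocal of `1/γ + h`, the bound on the compressed `Φ(ρ)`.
  have hc0 : 0 < c := by positivity
  refine ⟨c • (R * (P' * Z * P') * R), ⟨smul_nonneg hc0.le (sqrt_conj_nonneg Q hK0), ?_⟩, ?_⟩
  · have h1 : Phi Q (c • (R * (P' * Z * P') * R)) = c • (P * Phi Q r.rho * P) := by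
      rw [← hPhi, ← partialTrace_smul, Phi]
      congr 1
      rw [Matrix.mul_smul, Matrix.smul_mul]
      congr 1
      calc invSqrt Q * (R * (P' * Z * P') * R) * invSqrt Q
          = (invSqrt Q * R) * (P' * Z * P') * (R * invSqrt Q) := by simp only [mul_assoc]
        _ = P' * Z * P' := by
          rw [hR, invSqrt_mul_sqrt hQ hU, sqrt_mul_invSqrt hQ hU, one_mul, mul_one]
    have hH : (Phi Q r.rho - r.decomp).IsHermitian :=
      (Phi_isHermitian Q hρ.1.isHermitian).sub
        (by rw [Record.decomp_eq]; exact specOp_isHermitian _ _)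
    have h2 : Phi Q r.rho ≤ specOp r.U (fun j => r.lam j + h) := by
      have h3 := (le_norm_smul_one hH).trans
        (smul_le_smul_of_nonneg_right herr zero_le_one)
      rw [sub_le_iff_le_add, Record.decomp_eq, ← specOp_const r.U, specOp_add] at h3
      convert h3 using 2
      ext j
      ring
    have h4 := conjTranspose_mul_mul_le h2 P
    rw [hPH.eq, hP, specOp_mul, specOp_mul, ← hP] at h4
    have h5 : specOp r.U (fun j => (if j ∈ r.bigS γ then 0 else 1) * (r.lam j + h) *
        (if j ∈ r.bigS γ then 0 else 1)) ≤ (1 / γ + h) • 1 := by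
      rw [← specOp_const r.U]
      refine specOp_mono _ fun j => ?_
      split_ifs with hj
      · simp only [zero_mul]; positivity
      · rw [Record.mem_bigS, not_lt] at hj
        have : r.lam j ≤ 1 / γ := by rw [le_div_iff₀ hγ]; linarith
        linarith
    rw [h1]
    calc c • (P * Phi Q r.rho * P) ≤ c • ((1 / γ + h) • (1 : Op N)) :=
          smul_le_smul_of_nonneg_left (h4.trans h5) hc0.le
      _ = 1 := by
        rw [smul_smul, hc]
        have : γ / (1 + γ * h) * (1 / γ + h) = 1 := by
          have : 0 < 1 + γ * h := by positivity
          field_simp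
        rw [this, one_smul]
  -- With `Z = C Cᴴ`, the squared Hilbert–Schmidt norms of `R C`, `R S' C` and `R P' C` are the
  -- trace of `ρ`, the part removed and the trace that remains before scaling.
  · obtain ⟨C, hC⟩ := CStarAlgebra.nonneg_iff_eq_mul_star_self.mp hZ0
    rw [Matrix.star_eq_conjTranspose] at hC
    have hconj : ∀ {E : BiOp M N}, E.IsHermitian →
        (R * E * C) * (R * E * C)ᴴ = R * (E * Z * E) * R := fun {E} hE => by
      rw [Matrix.conjTranspose_mul, Matrix.conjTranspose_mul, hRH.eq, hE.eq, hC]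
      simp only [mul_assoc]
    have htr : ∀ E : BiOp M N, (R * E * R).trace = (Q * E).trace := fun E => by
      rw [Matrix.trace_mul_comm, ← mul_assoc, hRR]
    have hG : ((R * 1 * C) * (R * 1 * C)ᴴ).trace.re = 1 := by
      rw [hconj Matrix.isHermitian_one, htr, one_mul, mul_one, hZ,
        trace_mul_invSqrt_conj hQ hU, hρ.2, Complex.one_re]
    have hSZS : 0 ≤ S' * Z * S' := by
      have := conjTranspose_mul_mul_le hZ0 S'
      rw [hS'H.eq] at this
      simpa using this
    have hB : ((R * S' * C) * (R * S' * C)ᴴ).trace.re ≤ x ^ 2 := by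
      rw [hconj hS'H, htr]
      refine (le_abs_self _).trans ((abs_trace_mul_re_le (isHermitian_of_nonneg hQ) hSZS).trans ?_)
      refine le_trans (mul_le_mul_of_nonneg_left ?_ (norm_nonneg Q)) hs
      rw [← trace_partialTrace, hS', partialTrace_mul_one_kronecker,
        partialTrace_one_kronecker_mul, Matrix.trace_mul_comm, ← mul_assoc, hSS,
        Matrix.trace_mul_comm]
      exact trace_mul_decomp_le hρ hh herr
    have h6 := one_sub_two_mul_le_trace hx hG hB
    have h7 : R * 1 * C - R * S' * C = R * P' * C := by
      rw [hPS', mul_sub, sub_mul]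
    rw [h7, hconj hP'H] at h6
    rw [trace_real_smul_re, hc]
    have h8 : 0 < 1 + γ * h := by positivity
    calc γ * (1 - 2 * x) ≤ γ * (R * (P' * Z * P') * R).trace.re :=
          mul_le_mul_of_nonneg_left h6 hγ.le
      _ = _ := by field_simp

end Accept

/-! ### Constants in the acceptance guarantees -/

section AcceptBounds

variable {M N : ℕ} {Q : BiOp M N} {ε γ : ℝ} {r : Record M N}

theorem kappa_mul_delta_le (hM : 0 < M) (hN : 0 < N) (hU : IsUnit Q) (ε : ℝ) :
    kappa Q * delta Q ε ≤ ε ^ 2 / 8 := by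
  have h := one_le_kappa hM hN hU
  have h1 : kappa Q * delta Q ε = ε ^ 2 / 8 / kappa Q := by
    rw [delta]
    field_simp
  rw [h1]
  exact div_le_self (by positivity) h

theorem exists_primalFeasible_of_exact (hM : 0 < M) (hN : 0 < N) (hQ : 0 ≤ Q) (hU : IsUnit Q)
    (hε : 0 < ε) (hγ : 0 < γ) (hρ : IsDensity r.rho) (hr : Phi Q r.rho = r.decomp)
    (hacc : r.AcceptTest Q ε γ) :
    ∃ X : BiOp M N, PrimalFeasible Q X ∧ (1 - ε) * γ ≤ X.trace.re := by
  -- Acceptance gives `‖Q‖ s ≤ κ δ ≤ ε² / 8`, so `x = ε / 2` is admissible and `1 - 2 x = 1 - ε`.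
  have hs : ‖Q‖ * (r.smallS γ + N * 0) ≤ (ε / 2) ^ 2 := by
    have h1 : ‖Q‖ * r.smallS γ ≤ ‖Q‖ * (delta Q ε * ‖Q⁻¹‖) :=
      mul_le_mul_of_nonneg_left hacc (norm_nonneg Q)
    have h2 := kappa_mul_delta_le hM hN hU ε
    rw [kappa] at h2
    nlinarith [sq_nonneg ε]
  obtain ⟨X, hX, h⟩ := exists_primalFeasible_of_decomp hQ hU hγ hρ le_rfl (half_pos hε)
    (by rw [hr, sub_self, norm_zero]) hs
  exact ⟨X, hX, by linarith⟩

theorem zero_primalFeasible (Q : BiOp M N) : PrimalFeasible Q 0 := by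
  refine ⟨le_rfl, ?_⟩
  have h : Phi Q 0 = 0 := by
    ext i j
    simp [Phi, partialTrace_apply]
  rw [h]
  exact zero_le_one

/-- If the eigenvalues above `1 / γ` carry little weight, then `γ` cannot be large. -/
theorem one_le_of_decomp (hQ : 0 ≤ Q) (hU : IsUnit Q) (hγ : 0 < γ) (hρ : IsDensity r.rho) {h : ℝ}
    (herr : ‖Phi Q r.rho - r.decomp‖ ≤ h) :
    1 ≤ ‖Q‖ * (r.smallS γ + N * h) + ‖Q‖ * (N / γ) := by
  have hρ0 : 0 ≤ r.rho := Matrix.nonneg_iff_posSemidef.mpr hρ.1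
  -- With `Z = Q^{-1/2} ρ Q^{-1/2}`: `1 = Tr ρ = Tr (Q Z) ≤ ‖Q‖ Tr Z`, and `Tr Z = Tr Φ(ρ)` is
  -- within `N h` of `∑ λ_j`.
  have h1 := (le_abs_self _).trans (abs_trace_mul_re_le (isHermitian_of_nonneg hQ)
    (invSqrt_conj_nonneg Q hρ0))
  rw [trace_mul_invSqrt_conj hQ hU, hρ.2, Complex.one_re, ← trace_partialTrace] at h1
  have hH : (Phi Q r.rho - r.decomp).IsHermitian :=
    (Phi_isHermitian Q hρ.1.isHermitian).sub (by rw [Record.decomp_eq]; exact specOp_isHermitian _ _)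
  have h2 := (le_abs_self _).trans (abs_trace_re_le hH)
  rw [Matrix.trace_sub, Complex.sub_re, Fintype.card_fin, Record.decomp_eq,
    specOp_trace_re, ← Record.decomp_eq] at h2
  have h3 : ∑ j, r.lam j ≤ r.smallS γ + N / γ := by
    have h4 : ∀ j, r.lam j ≤ (if j ∈ r.bigS γ then r.lam j else 0) + 1 / γ := by
      intro j
      split_ifs with hj
      · have : 0 < 1 / γ := by positivity
        linarith
      · rw [Record.mem_bigS, not_lt] at hj
        rw [zero_add, le_div_iff₀ hγ]
        linarith
    refine (Finset.sum_le_sum fun j _ => h4 j).trans (le_of_eq ?_)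
    rw [Finset.sum_add_distrib, ← Record.smallS_eq]
    simp [div_eq_mul_inv]
  have h5 : (N : ℝ) * ‖Phi Q r.rho - r.decomp‖ ≤ N * h :=
    mul_le_mul_of_nonneg_left herr (by positivity)
  rw [← mul_add]
  refine h1.trans (mul_le_mul_of_nonneg_left ?_ (norm_nonneg Q))
  change (Phi Q r.rho).trace.re ≤ _
  linarith

/-- Imprecision costs the factor `1 + γ h`, harmless only if `γ` is not large. Acceptance itself
bounds `γ` through `one_le_of_decomp`, which gives `γ h ≤ ε`. -/
theorem exists_primalFeasible_of_acceptPrecision (hM : 0 < M) (hN : 0 < N)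
    (hI : IsInteractiveMeasurement Q) (hU : IsUnit Q)
    (hε : 0 < ε) (hγ : 0 < γ) (hp : AcceptPrecision Q ε r) (hacc : r.AcceptTest Q ε γ) :
    ∃ X : BiOp M N, PrimalFeasible Q X ∧ (1 - 2 * ε) * γ ≤ X.trace.re := by
  -- For `ε ≥ 1/2` the required trace is at most `0`, and `X = 0` suffices.
  rcases le_or_gt (1 / 2) ε with hε2 | hε2
  · refine ⟨0, zero_primalFeasible Q, ?_⟩
    rw [Matrix.trace_zero, Complex.zero_re]
    exact mul_nonpos_of_nonpos_of_nonneg (by linarith) hγ.le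
  have hQ := hI.nonneg
  obtain ⟨hρ, herr⟩ := hp
  have hδ := delta_pos hM hN hU hε
  have hn := hI.one_le_norm_inv hM hN hU
  have hκδ := kappa_mul_delta_le hM hN hU ε
  have hNpos : (0 : ℝ) < N := by exact_mod_cast hN
  set h := delta Q ε / (4 * N * ‖Q⁻¹‖) with hh
  have hh0 : 0 ≤ h := by positivity
  have hNh : N * h ≤ delta Q ε * ‖Q⁻¹‖ / 4 := by
    have h1 : N * h = delta Q ε / 4 / ‖Q⁻¹‖ := by
      rw [hh]; field_simp
    rw [h1]
    calc delta Q ε / 4 / ‖Q⁻¹‖ ≤ delta Q ε / 4 := div_le_self (by positivity) hn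
      _ ≤ delta Q ε * ‖Q⁻¹‖ / 4 := by nlinarith
  have hs : ‖Q‖ * (r.smallS γ + N * h) ≤ (ε / 2) ^ 2 := by
    have h1 : ‖Q‖ * (r.smallS γ + N * h) ≤
        ‖Q‖ * (delta Q ε * ‖Q⁻¹‖ + delta Q ε * ‖Q⁻¹‖ / 4) :=
      mul_le_mul_of_nonneg_left (add_le_add hacc hNh) (norm_nonneg Q)
    rw [kappa] at hκδ
    nlinarith [sq_nonneg ε]
  obtain ⟨X, hX, hle⟩ := exists_primalFeasible_of_decomp hQ hU hγ hρ hh0 (half_pos hε) herr.le hs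
  refine ⟨X, hX, ?_⟩
  have h1 := one_le_of_decomp hQ hU hγ hρ herr.le
  have h2 : γ ≤ 2 * N * ‖Q‖ := by
    -- The other term is at most `(ε / 2)²`, which is below `1/2`.
    have h3 : 1 / 2 ≤ ‖Q‖ * (N / γ) := by nlinarith
    rw [← mul_div_assoc, le_div_iff₀ hγ] at h3
    linarith
  have h3 : γ * h ≤ ε := by
    have h4 : γ * h ≤ ‖Q‖ * 2 * (N * h) := by
      calc γ * h ≤ 2 * N * ‖Q‖ * h := mul_le_mul_of_nonneg_right h2 hh0
        _ = _ := by ring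
    have h5 : ‖Q‖ * 2 * (N * h) ≤ ‖Q‖ * 2 * (delta Q ε * ‖Q⁻¹‖ / 4) :=
      mul_le_mul_of_nonneg_left hNh (by positivity)
    rw [kappa] at hκδ
    nlinarith
  have h6 : (1 - 2 * ε) * γ * (1 + γ * h) ≤ X.trace.re * (1 + γ * h) := by
    refine le_trans ?_ hle
    have h7 : (1 - 2 * ε) * (1 + γ * h) ≤ 1 - 2 * (ε / 2) := by nlinarith
    nlinarith
  exact le_of_mul_le_mul_right h6 (by positivity)

end AcceptBounds

/-! ### The matrix multiplicative weights method -/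

section MultiplicativeWeights

/-- The right factor is the guaranteed average payoff: `η²/12` is the precision allowance and `η²/3`
absorbs `ln(NM)`. To second order it equals `1 - η + η²/12`, which `1 + 2η` compensates up to `η =
1/2`. -/
theorem one_le_mul_exp_neg_bound {η : ℝ} (h0 : 0 ≤ η) (h1 : η ≤ 1 / 2) :
    1 ≤ (1 + 2 * η) * (Real.exp (-η) * (1 - η ^ 2 / 12) - η ^ 2 / 3) := by
  have h := Real.exp_bound (x := -η) (by rw [abs_neg, abs_of_nonneg h0]; linarith) (n := 4)
    (by norm_num)
  rw [abs_neg, abs_of_nonneg h0, abs_le] at h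
  simp only [Finset.sum_range_succ, Finset.sum_range_zero, Nat.factorial] at h
  norm_num at h
  -- The Taylor remainder `5 η⁴ / 96` is folded into the cubic term by `η ≤ 1/2`: `1/6 + 5/192 <
  -- 39/200`.
  have h2 : 1 - η + η ^ 2 / 2 - 39 / 200 * η ^ 3 ≤ Real.exp (-η) := by
    have h3 : η ^ 4 ≤ η ^ 3 * (1 / 2) := by
      rw [pow_succ η 3]; gcongr
    nlinarith [h.1, pow_nonneg h0 3]
  have h4 : (1 - η + η ^ 2 / 2 - 39 / 200 * η ^ 3) * (1 - η ^ 2 / 12) ≤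
      Real.exp (-η) * (1 - η ^ 2 / 12) := by
    apply mul_le_mul_of_nonneg_right h2
    nlinarith
  have h5 : 1 - η + η ^ 2 / 12 - 133 / 1000 * η ^ 3 ≤
      Real.exp (-η) * (1 - η ^ 2 / 12) - η ^ 2 / 3 := by
    have h3 : η ^ 4 ≤ η ^ 3 * (1 / 2) := by
      rw [pow_succ η 3]; gcongr
    nlinarith [pow_nonneg h0 3, pow_nonneg h0 5]
  have h6 : 1 ≤ (1 + 2 * η) * (1 - η + η ^ 2 / 12 - 133 / 1000 * η ^ 3) := by
    have h7 : 0 ≤ 1 - 23 / 12 * η - 266 / 1000 * η ^ 3 := by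
      have : η ^ 3 ≤ (1 / 2) ^ 3 := pow_le_pow_left₀ h0 h1 3
      norm_num at this
      linarith
    nlinarith [mul_nonneg h0 h7, pow_nonneg h0 3]
  exact h6.trans (mul_le_mul_of_nonneg_left h5 (by positivity))

variable {ι : Type*} [Fintype ι] [DecidableEq ι]

/-- Golden–Thompson splits off `exp (-ηK)`, and `0 ≤ K ≤ 1` bounds it by `1 - η exp (-η) K`. -/
theorem trace_exp_sub_smul_le [Nonempty ι] {A K : Matrix ι ι ℂ} (hA : A.IsHermitian) (hK0 : 0 ≤ K)
    (hK1 : K ≤ 1) {η : ℝ} (hη : 0 ≤ η) :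
    (NormedSpace.exp (A + -(η • K))).trace.re ≤ (NormedSpace.exp A).trace.re -
      η * Real.exp (-η) * (NormedSpace.exp A * K).trace.re := by
  have hKH : (-(η • K)).IsHermitian := (smul_isHermitian (isHermitian_of_nonneg hK0) η).neg
  refine (golden_thompson hA hKH).trans ?_
  have h1 : NormedSpace.exp (-(η • K)) ≤ 1 + Real.exp (-η) • -(η • K) :=
    exp_le_one_add_smul (c := η) (neg_le_neg (smul_le_smul_of_nonneg_left hK1 hη))
      (neg_nonpos.mpr (smul_nonneg hη hK0))
  have h2 := trace_mul_re_mono h1 (exp_nonneg hA)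
  rw [Matrix.trace_mul_comm] at h2
  refine h2.trans (le_of_eq ?_)
  rw [add_mul, one_mul, smul_neg, smul_smul, neg_mul, Matrix.smul_mul, Matrix.trace_add,
    Matrix.trace_neg, Complex.add_re, Complex.neg_re, trace_real_smul_re,
    Matrix.trace_mul_comm K]
  ring

/-- The matrix multiplicative weights bound. -/
theorem trace_exp_neg_sum_le [Nonempty ι] (K : ℕ → Matrix ι ι ℂ) {η c : ℝ} (hη : 0 ≤ η) (T : ℕ)
    (hK0 : ∀ t < T, 0 ≤ K t) (hK1 : ∀ t < T, K t ≤ 1)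
    (hc : ∀ t < T, c * (NormedSpace.exp (-(η • ∑ i ∈ Finset.range t, K i))).trace.re ≤
      (NormedSpace.exp (-(η • ∑ i ∈ Finset.range t, K i)) * K t).trace.re) :
    (NormedSpace.exp (-(η • ∑ i ∈ Finset.range T, K i))).trace.re ≤
      Fintype.card ι * Real.exp (-(η * Real.exp (-η) * c * T)) := by
  induction T with
  | zero => simp
  | succ T ih =>
    have ih' := ih (fun t ht => hK0 t (by omega)) (fun t ht => hK1 t (by omega))
      (fun t ht => hc t (by omega))
    have hS : (∑ i ∈ Finset.range T, K i).IsHermitian := isHermitian_of_nonneg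
      (Finset.sum_nonneg fun i hi => hK0 i (by rw [Finset.mem_range] at hi; omega))
    have hH : (-(η • ∑ i ∈ Finset.range T, K i)).IsHermitian := (smul_isHermitian hS η).neg
    have h1 := trace_exp_sub_smul_le hH (hK0 T (by omega)) (hK1 T (by omega)) hη
    have h2 := hc T (by omega)
    have h0 := trace_re_nonneg (exp_nonneg hH)
    rw [Finset.sum_range_succ, smul_add, neg_add]
    set w := (NormedSpace.exp (-(η • ∑ i ∈ Finset.range T, K i))).trace.re with hw
    have hp : 0 ≤ η * Real.exp (-η) := by positivity
    calc _ ≤ _ := h1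
      _ ≤ w - η * Real.exp (-η) * (c * w) := by
        have := mul_le_mul_of_nonneg_left h2 hp
        linarith
      _ = w * (-(η * Real.exp (-η) * c) + 1) := by ring
      _ ≤ w * Real.exp (-(η * Real.exp (-η) * c)) :=
        mul_le_mul_of_nonneg_left (Real.add_one_le_exp _) h0
      _ ≤ (Fintype.card ι * Real.exp (-(η * Real.exp (-η) * c * T))) *
          Real.exp (-(η * Real.exp (-η) * c)) :=
        mul_le_mul_of_nonneg_right ih' (Real.exp_pos _).le
      _ = _ := by
        rw [mul_assoc, ← Real.exp_add]
        push_cast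
        ring_nf

end MultiplicativeWeights

/-! ### Dual certificates from rejecting runs -/

section Weights

variable {M N : ℕ} {Q : BiOp M N} {ε γ : ℝ} {e : ℕ → Record M N}

/-- The loss operator `δ Φ*(Y_t)` of iteration `t`. -/
noncomputable def loss (Q : BiOp M N) (ε γ : ℝ) (e : ℕ → Record M N) (t : ℕ) : BiOp M N :=
  delta Q ε • PhiStar Q ((e t).Y γ)

theorem PhiStar_sum (Q : BiOp M N) (Y : ℕ → Op N) (t : ℕ) :
    PhiStar Q (∑ i ∈ Finset.range t, Y i) = ∑ i ∈ Finset.range t, PhiStar Q (Y i) := by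
  induction t with
  | zero => simp [PhiStar_zero]
  | succ t ih => rw [Finset.sum_range_succ, Finset.sum_range_succ, PhiStar_add, ih]

theorem sum_loss (Q : BiOp M N) (ε γ : ℝ) (e : ℕ → Record M N) (t : ℕ) :
    ∑ i ∈ Finset.range t, loss Q ε γ e i =
      delta Q ε • PhiStar Q (∑ i ∈ Finset.range t, (e i).Y γ) := by
  simp only [loss]
  rw [← Finset.smul_sum, PhiStar_sum]

theorem bigW_eq (Q : BiOp M N) (ε γ : ℝ) (e : ℕ → Record M N) (t : ℕ) :
    bigW Q ε γ e t =
      NormedSpace.exp (-((ε * γ / 2) • ∑ i ∈ Finset.range t, loss Q ε γ e i)) := by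
  rw [bigW, sum_loss, Complex.coe_smul, smul_smul, ← neg_smul]
  congr 2
  ring

theorem loss_isHermitian (Q : BiOp M N) (ε γ : ℝ) (e : ℕ → Record M N) (t : ℕ) :
    (loss Q ε γ e t).IsHermitian :=
  smul_isHermitian (PhiStar_isHermitian Q ((e t).Y_isHermitian γ)) _

theorem exponent_isHermitian (Q : BiOp M N) (ε γ : ℝ) (e : ℕ → Record M N) (t : ℕ) :
    (-((ε * γ / 2) • ∑ i ∈ Finset.range t, loss Q ε γ e i)).IsHermitian := by
  refine (smul_isHermitian ?_ _).neg
  rw [Matrix.IsHermitian, Matrix.conjTranspose_sum]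
  exact Finset.sum_congr rfl fun i _ => loss_isHermitian Q ε γ e i

theorem bigW_nonneg (Q : BiOp M N) (ε γ : ℝ) (e : ℕ → Record M N) (t : ℕ) :
    0 ≤ bigW Q ε γ e t := by
  rw [bigW_eq]
  exact exp_nonneg (exponent_isHermitian Q ε γ e t)

theorem bigW_trace_pos (hM : 0 < M) (hN : 0 < N) (Q : BiOp M N) (ε γ : ℝ) (e : ℕ → Record M N)
    (t : ℕ) : 0 < (bigW Q ε γ e t).trace.re := by
  have : Nonempty (Fin M × Fin N) := ⟨(⟨0, hM⟩, ⟨0, hN⟩)⟩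
  have h := bigW_nonneg Q ε γ e t
  have hu : IsUnit (bigW Q ε γ e t) := by
    rw [bigW_eq]
    exact Matrix.isUnit_exp _
  have h2 : (bigW Q ε γ e t).PosDef :=
    (Matrix.nonneg_iff_posSemidef.mp h).posDef_iff_isUnit.mpr hu
  exact (Complex.pos_iff.mp h2.trace_pos).1

theorem trace_eq_ofReal {ι : Type*} [Fintype ι] {W : Matrix ι ι ℂ} (hW : W.IsHermitian) :
    W.trace = (W.trace.re : ℂ) := by
  have h : star W.trace = W.trace := by
    rw [← Matrix.trace_conjTranspose, hW.eq]
  exact (Complex.conj_eq_iff_re.mp h).symm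

theorem normalize_eq {W : BiOp M N} (hW : W.IsHermitian) :
    normalize W = (W.trace.re)⁻¹ • W := by
  rw [normalize, trace_eq_ofReal hW, ← Complex.ofReal_inv, Complex.coe_smul, Complex.ofReal_re]

theorem isDensity_normalize {W : BiOp M N} (hW : 0 ≤ W) (hpos : 0 < W.trace.re) :
    IsDensity (normalize W) := by
  constructor
  · rw [normalize_eq (isHermitian_of_nonneg hW)]
    exact Matrix.nonneg_iff_posSemidef.mp (smul_nonneg (by positivity) hW)
  · have h : W.trace ≠ 0 := fun h => by
      rw [h] at hpos
      simp at hpos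
    rw [normalize, Matrix.trace_smul, smul_eq_mul, inv_mul_cancel₀ h]

theorem smallS_pos (hM : 0 < M) (hN : 0 < N) (hU : IsUnit Q) (hε : 0 < ε) {r : Record M N}
    (hr : ¬ r.AcceptTest Q ε γ) : 0 < r.smallS γ := by
  rw [Record.AcceptTest, not_le] at hr
  exact (mul_nonneg (delta_pos hM hN hU hε).le (norm_nonneg _)).trans_lt hr

theorem loss_nonneg (hM : 0 < M) (hN : 0 < N) (hU : IsUnit Q) (hε : 0 < ε) {t : ℕ}
    (hr : ¬ (e t).AcceptTest Q ε γ) : 0 ≤ loss Q ε γ e t :=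
  smul_nonneg (delta_pos hM hN hU hε).le
    (PhiStar_nonneg Q (Record.Y_nonneg (smallS_pos hM hN hU hε hr)))

/-- This is the purpose of the acceptance threshold: `Y_t ≤ 1/s` gives `Φ*(Y_t) ≤ ‖Q⁻¹‖ / s`, and a
failed test means `s > δ ‖Q⁻¹‖`. -/
theorem loss_le_one (hM : 0 < M) (hN : 0 < N) (hQ : 0 ≤ Q) (hU : IsUnit Q) (hε : 0 < ε) {t : ℕ}
    (hr : ¬ (e t).AcceptTest Q ε γ) : loss Q ε γ e t ≤ 1 := by
  have hs := smallS_pos hM hN hU hε hr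
  have h1 := PhiStar_le_smul_one hQ (by positivity) (Record.Y_le hs)
  have hδ := delta_pos hM hN hU hε
  rw [Record.AcceptTest, not_le] at hr
  have h2 : delta Q ε * (1 / (e t).smallS γ * ‖Q⁻¹‖) ≤ 1 := by
    rw [one_div, ← mul_assoc, mul_comm (delta Q ε), mul_assoc, inv_mul_le_iff₀ hs, mul_one]
    exact hr.le
  calc loss Q ε γ e t ≤ delta Q ε • ((1 / (e t).smallS γ * ‖Q⁻¹‖) • (1 : BiOp M N)) :=
        smul_le_smul_of_nonneg_left h1 hδ.le
    _ ≤ 1 := by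
      rw [smul_smul]
      simpa using smul_le_smul_of_nonneg_right h2 (zero_le_one (α := BiOp M N))

theorem hsInner_normalize {W : BiOp M N} (hW : W.IsHermitian) (B : BiOp M N) :
    hsInner (normalize W) B = (W * B).trace.re / W.trace.re := by
  rw [normalize_eq hW, hsInner_of_isHermitian (smul_isHermitian hW _), Matrix.smul_mul,
    trace_real_smul_re]
  ring

/-- If all iterations are carried out with the precision required for rejection, then a suitable
multiple of the average of the `Y_t` is dual feasible. -/
theorem exists_dualFeasible_of_rejects (hMN : 2 ≤ N * M) (hI : IsInteractiveMeasurement Q)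
    (hU : IsUnit Q) (hε : 0 < ε) (hγ : 0 < γ) (hrej : Rejects Q ε γ e)
    (hp : ∀ t < bigT Q ε γ, RejectPrecision Q ε γ e t) :
    ∃ Y : Op N, DualFeasible Q Y ∧ Y.trace.re ≤ (1 + ε) * γ := by
  -- If `(1 + ε) γ ≥ 1`, the trace-one dual feasible operator suffices. Otherwise `γ < 1` and `ε γ <
  -- 1`, whence `η ≤ 1/2` and `2 η ≤ ε`.
  rcases le_or_gt 1 ((1 + ε) * γ) with h1 | h1
  · obtain ⟨Y, hY, hY1⟩ := hI.exists_dualFeasible hU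
    exact ⟨Y, hY, hY1.le.trans h1⟩
  have hM : 0 < M := Nat.pos_of_ne_zero fun h => by simp [h] at hMN
  have hN : 0 < N := Nat.pos_of_ne_zero fun h => by simp [h] at hMN
  have : Nonempty (Fin M × Fin N) := ⟨(⟨0, hM⟩, ⟨0, hN⟩)⟩
  have hQ := hI.nonneg
  have hδ := delta_pos hM hN hU hε
  set δ := delta Q ε with hδdef
  set T := bigT Q ε γ with hT
  set η := ε * γ / 2 with hη
  have hη0 : 0 < η := by positivity
  have hη1 : η ≤ 1 / 2 := by rw [hη]; nlinarith
  have hηε : 2 * η ≤ ε := by rw [hη]; nlinarith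
  set L := Real.log ((N : ℝ) * M) with hL
  have hNM : (2 : ℝ) ≤ (N : ℝ) * M := by exact_mod_cast hMN
  have hL0 : 0 < L := Real.log_pos (by linarith)
  -- This is the definition of `T` with `ε³ γ³ = 8 η³`. It makes `L = ln(NM)` at most `η δ T · η² /
  -- 3`.
  have hTL : 3 * L / (η ^ 3 * δ) ≤ T := by
    refine le_trans (le_of_eq ?_) (Nat.le_ceil _)
    rw [hη, ← hδdef, ← hL]
    field_simp
    norm_num
  have hT0 : (0 : ℝ) < T := lt_of_lt_of_le (by positivity) hTL
  have hpot := trace_exp_neg_sum_le (loss Q ε γ e) (c := δ * (1 - η ^ 2 / 12)) hη0.le T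
    (fun t ht => loss_nonneg hM hN hU hε (hrej t ht))
    (fun t ht => loss_le_one hM hN hQ hU hε (hrej t ht)) (fun t ht => by
      rw [← bigW_eq]
      have h2 := hp t ht
      have hW := isHermitian_of_nonneg (bigW_nonneg Q ε γ e t)
      rw [RejectPrecision, hsInner_normalize hW, gt_iff_lt,
        lt_div_iff₀ (bigW_trace_pos hM hN Q ε γ e t)] at h2
      rw [loss, Matrix.mul_smul, trace_real_smul_re, mul_assoc]
      exact mul_le_mul_of_nonneg_left h2.le hδ.le)
  have hcard : (Fintype.card (Fin M × Fin N) : ℝ) = Real.exp L := by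
    rw [hL, Real.exp_log (by linarith)]
    simp [mul_comm]
  rw [hcard, ← Real.exp_add] at hpot
  have h3 := le_smul_one_of_trace_exp_le (exponent_isHermitian Q ε γ e T) hpot
  set f := Real.exp (-η) * (1 - η ^ 2 / 12) - η ^ 2 / 3 with hf
  have hf1 : 1 ≤ (1 + ε) * f := by
    have h4 := one_le_mul_exp_neg_bound hη0.le hη1
    rw [← hf] at h4
    -- The sign of `f` is needed to pass from `1 + 2 η` to `1 + ε`.
    have hf0 : 0 ≤ f := by
      by_contra hneg
      push Not at hneg
      nlinarith
    nlinarith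
  have h5 : L + -(η * Real.exp (-η) * (δ * (1 - η ^ 2 / 12)) * T) ≤ -(η * δ * (T * f)) := by
    have h6 : L ≤ η * δ * T * (η ^ 2 / 3) := by
      rw [div_le_iff₀ (by positivity)] at hTL
      nlinarith
    rw [hf]
    nlinarith
  have h7 : (T * f) • (1 : BiOp M N) ≤ PhiStar Q (∑ i ∈ Finset.range T, (e i).Y γ) := by
    have h8 := h3.trans (smul_le_smul_of_nonneg_right h5 zero_le_one)
    rw [sum_loss, smul_smul, ← hδdef, ← hη, neg_smul, neg_le_neg_iff, mul_smul] at h8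
    have h9 := smul_le_smul_of_nonneg_left h8 (inv_nonneg.mpr (mul_pos hη0 hδ).le)
    rwa [inv_smul_smul₀ (mul_pos hη0 hδ).ne', inv_smul_smul₀ (mul_pos hη0 hδ).ne'] at h9
  have hs : ∀ i < T, 0 < (e i).smallS γ := fun i hi => smallS_pos hM hN hU hε (hrej i hi)
  have hc0 : 0 ≤ (1 + ε) / T := by positivity
  refine ⟨((1 + ε) / T) • ∑ i ∈ Finset.range T, (e i).Y γ, ⟨smul_nonneg hc0
    (Finset.sum_nonneg fun i hi => Record.Y_nonneg (hs i (Finset.mem_range.mp hi))), ?_⟩, ?_⟩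
  · rw [PhiStar_smul]
    have h10 := smul_le_smul_of_nonneg_left h7 hc0
    refine le_trans ?_ h10
    rw [smul_smul]
    have h11 : 1 ≤ (1 + ε) / T * (T * f) := by
      have : (1 + ε) / T * (T * f) = (1 + ε) * f := by field_simp
      rwa [this]
    simpa using smul_le_smul_of_nonneg_right h11 (zero_le_one (α := BiOp M N))
  · rw [trace_real_smul_re, Matrix.trace_sum, Complex.re_sum]
    have h12 : ∑ i ∈ Finset.range T, ((e i).Y γ).trace.re ≤ T * γ := by
      refine (Finset.sum_le_sum fun i hi =>
        Record.trace_Y_le hγ (hs i (Finset.mem_range.mp hi))).trans (le_of_eq ?_)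
      simp
    calc _ ≤ (1 + ε) / T * (T * γ) := mul_le_mul_of_nonneg_left h12 hc0
      _ = (1 + ε) * γ := by field_simp

end Weights

/-! ### Existence, length and precision of runs -/

section Runs

variable {M N : ℕ} {Q : BiOp M N} {ε γ : ℝ} {e : ℕ → Record M N}

theorem hsInner_PhiStar (Q : BiOp M N) {ρ : BiOp M N} (hρ : ρ.IsHermitian) (Y : Op N) :
    hsInner ρ (PhiStar Q Y) = (Phi Q ρ * Y).trace.re := by
  rw [hsInner_of_isHermitian hρ, trace_Phi_mul]

theorem exists_record_of_isHermitian (ρ : BiOp M N) (hρ : ρ.IsHermitian) (Q : BiOp M N) :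
    ∃ r : Record M N, r.rho = ρ ∧ Phi Q r.rho = r.decomp := by
  have hH := Phi_isHermitian Q hρ
  refine ⟨⟨ρ, hH.eigenvectorUnitary, hH.eigenvalues⟩, rfl, ?_⟩
  rw [Record.decomp_eq, specOp]
  have h := hH.spectral_theorem
  rw [Unitary.conjStarAlgAut_apply] at h
  exact h

theorem exists_exactRun (Q : BiOp M N) (ε γ : ℝ) : ∃ e : ℕ → Record M N, IsExactRun Q ε γ e := by
  let W : Op N → BiOp M N := fun S =>
    NormedSpace.exp (((-(ε * γ * delta Q ε / 2) : ℝ) : ℂ) • PhiStar Q S)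
  have hW : ∀ S : Op N, S.IsHermitian → (normalize (W S)).IsHermitian := fun S hS => by
    have h : (W S).IsHermitian := by
      refine Matrix.IsHermitian.exp ?_
      rw [Complex.coe_smul]
      exact smul_isHermitian (PhiStar_isHermitian Q hS) _
    rw [normalize_eq h]
    exact smul_isHermitian h _
  have hex : ∀ S : {S : Op N // S.IsHermitian}, ∃ r : Record M N,
      r.rho = normalize (W S) ∧ Phi Q r.rho = r.decomp := fun S =>
    exists_record_of_isHermitian _ (hW S S.2) Q
  choose g hg1 hg2 using hex
  -- The next record depends on the past only through `Y_0 + ⋯ + Y_{t-1}`. Carrying this sum with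
  -- its hermiticity makes the recursion total, also beyond the halting iteration.
  let S : ℕ → {S : Op N // S.IsHermitian} := fun t =>
    Nat.rec ⟨0, Matrix.isHermitian_zero⟩
      (fun _ S => ⟨S.1 + (g S).Y γ, S.2.add ((g S).Y_isHermitian γ)⟩) t
  have hS : ∀ t, ∑ i ∈ Finset.range t, (g (S i)).Y γ = (S t).1 := fun t => by
    induction t with
    | zero => rfl
    | succ t ih => rw [Finset.sum_range_succ, ih]
  refine ⟨fun t => g (S t), fun t _ => ⟨?_, hg2 _⟩⟩
  rw [hg1, bigW, hS]

theorem IsExactRun.isDensity (hM : 0 < M) (hN : 0 < N) (he : IsExactRun Q ε γ e) {t : ℕ}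
    (ht : Reached Q ε γ e t) : IsDensity (e t).rho := by
  rw [(he t ht).1]
  exact isDensity_normalize (bigW_nonneg Q ε γ e t) (bigW_trace_pos hM hN Q ε γ e t)

/-- By adjointness the inner product is `Tr (Φ(ρ_t) Y_t) = (1/s) ∑_{j ∈ S} λ_j = 1`. -/
theorem IsExactRun.rejectPrecision (hM : 0 < M) (hN : 0 < N) (hU : IsUnit Q) (hε : 0 < ε)
    (hγ : 0 < γ) (he : IsExactRun Q ε γ e) {t : ℕ} (ht : Reached Q ε γ e t)
    (hr : ¬ (e t).AcceptTest Q ε γ) : RejectPrecision Q ε γ e t := by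
  have hρ := (he.isDensity hM hN ht).1.isHermitian
  obtain ⟨h1, h2⟩ := he t ht
  rw [RejectPrecision, ← h1, hsInner_PhiStar Q hρ, h2,
    Record.trace_decomp_mul_Y (smallS_pos hM hN hU hε hr)]
  have : 0 < (ε * γ / 2) ^ 2 / 12 := by positivity
  linarith

theorem Rejects.reached (h : Rejects Q ε γ e) {t : ℕ} (ht : t < bigT Q ε γ) :
    Reached Q ε γ e t :=
  ⟨ht, fun i hi => h i (hi.trans ht)⟩

theorem iterations_le_bigT (Q : BiOp M N) (ε γ : ℝ) (e : ℕ → Record M N) :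
    iterations Q ε γ e ≤ bigT Q ε γ := by
  have h : {t | Reached Q ε γ e t} ⊆ (Finset.range (bigT Q ε γ) : Set ℕ) := fun t ht => by
    simpa using ht.1
  have h2 := Set.ncard_le_ncard h (Finset.finite_toSet _)
  rwa [Set.ncard_coe_finset, Finset.card_range] at h2

theorem accepts_or_rejects (Q : BiOp M N) (ε γ : ℝ) (e : ℕ → Record M N) :
    (∃ t, AcceptsAt Q ε γ e t) ∨ Rejects Q ε γ e := by
  classical
  by_cases h : Rejects Q ε γ e
  · exact Or.inr h
  · left
    simp only [Rejects, not_forall, not_not] at h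
    have h' : ∃ t, t < bigT Q ε γ ∧ (e t).AcceptTest Q ε γ := by
      obtain ⟨t, h1, h2⟩ := h
      exact ⟨t, h1, h2⟩
    refine ⟨Nat.find h', ⟨(Nat.find_spec h').1, fun i hi hacc => ?_⟩, (Nat.find_spec h').2⟩
    exact Nat.find_min h' hi ⟨hi.trans (Nat.find_spec h').1, hacc⟩

/-- Rounding up adds less than `1`, and the quotient is at least `1` because `ln(NM) ≥ 1/2` and `δ ≤
1/8`. -/
theorem bigT_le (hMN : 2 ≤ N * M) (hU : IsUnit Q) (hε : 0 < ε) (hγ : 0 < γ) (hε1 : ε ≤ 1)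
    (hγ1 : γ ≤ 1) :
    (bigT Q ε γ : ℝ) ≤ 25 * (Real.log ((N : ℝ) * M) / (ε ^ 3 * γ ^ 3 * delta Q ε)) := by
  have hM : 0 < M := Nat.pos_of_ne_zero fun h => by simp [h] at hMN
  have hN : 0 < N := Nat.pos_of_ne_zero fun h => by simp [h] at hMN
  have hδ := delta_pos hM hN hU hε
  have hκ := one_le_kappa hM hN hU
  have hNM : (2 : ℝ) ≤ (N : ℝ) * M := by exact_mod_cast hMN
  have hL : 1 / 2 ≤ Real.log ((N : ℝ) * M) :=
    le_trans (by linarith [Real.log_two_gt_d9]) (Real.log_le_log two_pos hNM)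
  have hδ1 : delta Q ε ≤ 1 / 8 := by
    rw [delta, div_le_div_iff₀ (by positivity) (by norm_num)]
    nlinarith
  have hden : ε ^ 3 * γ ^ 3 * delta Q ε ≤ 1 / 8 := by
    have h1 : ε ^ 3 ≤ 1 := pow_le_one₀ hε.le hε1
    have h2 : γ ^ 3 ≤ 1 := pow_le_one₀ hγ.le hγ1
    have h3 : ε ^ 3 * γ ^ 3 ≤ 1 := mul_le_one₀ h1 (by positivity) h2
    exact (mul_le_of_le_one_left hδ.le h3).trans hδ1
  have hx : 1 ≤ Real.log ((N : ℝ) * M) / (ε ^ 3 * γ ^ 3 * delta Q ε) := by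
    rw [le_div_iff₀ (by positivity)]
    linarith
  have h := (Nat.ceil_lt_add_one (a := 24 * Real.log ((N : ℝ) * M) /
    (ε ^ 3 * γ ^ 3 * delta Q ε)) (by positivity)).le
  rw [bigT]
  rw [mul_div_assoc] at h ⊢
  linarith

/-- Fewer than `T` losses, each at most `1`, enter the exponent. The bound does not depend on the
run. -/
theorem smul_one_le_bigW (hM : 0 < M) (hN : 0 < N) (hQ : 0 ≤ Q) (hU : IsUnit Q) (hε : 0 < ε)
    (hγ : 0 < γ) {t : ℕ} (ht : Reached Q ε γ e t) :
    Real.exp (-(ε * γ / 2 * bigT Q ε γ)) • 1 ≤ bigW Q ε γ e t := by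
  rw [bigW_eq]
  refine exp_smul_one_le_exp (exponent_isHermitian Q ε γ e t) ?_
  rw [neg_smul, neg_le_neg_iff, mul_smul]
  refine smul_le_smul_of_nonneg_left ?_ (by positivity)
  have h1 : ∑ i ∈ Finset.range t, loss Q ε γ e i ≤ (t : ℝ) • 1 := by
    refine (Finset.sum_le_sum fun i hi =>
      loss_le_one hM hN hQ hU hε (ht.2 i (Finset.mem_range.mp hi))).trans (le_of_eq ?_)
    rw [Finset.sum_const, Finset.card_range, Nat.cast_smul_eq_nsmul]
  refine h1.trans (smul_le_smul_of_nonneg_right ?_ zero_le_one)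
  exact_mod_cast ht.1.le

theorem smul_one_le_of_norm_sub_le {ι : Type*} [Fintype ι] [DecidableEq ι] {W V : Matrix ι ι ℂ} {w τ : ℝ}
    (hW : w • 1 ≤ W) (hWH : W.IsHermitian) (hV : V.IsHermitian) (h : ‖V - W‖ ≤ τ) :
    (w - τ) • 1 ≤ V := by
  have h1 := le_norm_smul_one (hWH.sub hV)
  rw [norm_sub_rev] at h1
  have h2 := h1.trans (smul_le_smul_of_nonneg_right h zero_le_one)
  rw [sub_smul, sub_le_iff_le_add]
  rw [sub_le_iff_le_add'] at h2
  exact hW.trans h2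

/-- The dimension cancels: numerator and denominator each move by at most `n τ`, while `Tr W ≥ n w`.
-/
theorem trace_div_sub_trace_div_le {ι : Type*} [Fintype ι] [DecidableEq ι] [Nonempty ι]
    {W V K : Matrix ι ι ℂ} {w τ : ℝ} (hw : 0 < w) (hW : w • 1 ≤ W) (hV0 : 0 ≤ V)
    (hVp : 0 < V.trace.re) (hWH : W.IsHermitian) (h : ‖V - W‖ ≤ τ) (hK0 : 0 ≤ K) (hK1 : K ≤ 1) :
    (V * K).trace.re / V.trace.re - (W * K).trace.re / W.trace.re ≤ 2 * τ / w := by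
  have hVH := isHermitian_of_nonneg hV0
  have hτ : 0 ≤ τ := (norm_nonneg _).trans h
  set n := (Fintype.card ι : ℝ) with hn
  have hn0 : 0 < n := by rw [hn]; exact_mod_cast Fintype.card_pos
  have hKn : K.trace.re ≤ n := by
    have := trace_re_mono hK1
    rwa [trace_one_re] at this
  have h1 : (V * K).trace.re - (W * K).trace.re ≤ τ * n := by
    have h2 := (le_abs_self _).trans (abs_trace_mul_re_le (hVH.sub hWH) hK0)
    rw [sub_mul, Matrix.trace_sub, Complex.sub_re] at h2
    exact h2.trans (mul_le_mul h hKn (trace_re_nonneg hK0) hτ)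
  have h2 : W.trace.re - V.trace.re ≤ τ * n := by
    have h3 := (neg_le_abs _).trans (abs_trace_re_le (hVH.sub hWH))
    rw [Matrix.trace_sub, Complex.sub_re, ← hn] at h3
    nlinarith
  have h3 : (V * K).trace.re ≤ V.trace.re := by
    have := trace_mul_re_mono hK1 hV0
    rwa [Matrix.trace_mul_comm, one_mul] at this
  have h4 := trace_mul_re_nonneg hV0 hK0
  have h5 : n * w ≤ W.trace.re := by
    have := trace_re_mono hW
    rw [trace_real_smul_re, trace_one_re] at this
    linarith
  have h6 : 0 < W.trace.re := lt_of_lt_of_le (by positivity) h5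
  set a := (V * K).trace.re
  set b := V.trace.re
  set c := W.trace.re
  set d := (W * K).trace.re
  have h7 : a / b - d / c = ((a - d) + a / b * (c - b)) / c := by
    field_simp
    ring
  have hab0 : 0 ≤ a / b := by positivity
  have hab1 : a / b ≤ 1 := (div_le_one hVp).mpr h3
  have h8 : a / b * (c - b) ≤ τ * n :=
    calc a / b * (c - b) ≤ a / b * (τ * n) := mul_le_mul_of_nonneg_left h2 hab0
      _ ≤ τ * n := mul_le_of_le_one_left (by positivity) hab1
  rw [h7, div_le_div_iff₀ h6 hw]
  calc ((a - d) + a / b * (c - b)) * w ≤ (τ * n + τ * n) * w := by gcongr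
    _ = 2 * τ * (n * w) := by ring
    _ ≤ 2 * τ * c := by gcongr

/-- Sufficiently accurate matrix exponentials and spectral decompositions guarantee the precision
required for acceptance and for rejection. -/
theorem exists_precision (hM : 0 < M) (hN : 0 < N) (hI : IsInteractiveMeasurement Q)
    (hU : IsUnit Q) (hε : 0 < ε) (hγ : 0 < γ) :
    ∃ τ : ℝ, 0 < τ ∧ ∀ e : ℕ → Record M N, IsApproxRun Q ε γ τ e →
      ∀ t, Reached Q ε γ e t → AcceptPrecision Q ε (e t) ∧
        (¬ (e t).AcceptTest Q ε γ → RejectPrecision Q ε γ e t) := by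
  have : Nonempty (Fin M × Fin N) := ⟨(⟨0, hM⟩, ⟨0, hN⟩)⟩
  have hQ := hI.nonneg
  have hδ := delta_pos hM hN hU hε
  have hn := hI.one_le_norm_inv hM hN hU
  have hN' : (0 : ℝ) < N := by exact_mod_cast hN
  set w := Real.exp (-(ε * γ / 2 * bigT Q ε γ)) with hw
  have hw0 : 0 < w := Real.exp_pos _
  set C := 2 / (w * delta Q ε) + γ with hC
  have hC0 : 0 < C := by positivity
  set b := (ε * γ / 2) ^ 2 / 12 with hb
  have hb0 : 0 < b := by positivity
  -- The three bounds keep the computed exponential positive definite, give the precision for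
  -- acceptance, and keep the total deficit `τ C` below `η² / 12`. In `C`, the term `2 / (w δ)`
  -- accounts for normalizing the perturbed exponential and `γ ≥ Tr Y_t` for the spectral
  -- decomposition.
  refine ⟨min (w / 2) (min (delta Q ε / (4 * N * ‖Q⁻¹‖)) (b / (2 * C))),
    lt_min (by positivity) (lt_min (by positivity) (by positivity)), ?_⟩
  set τ := min (w / 2) (min (delta Q ε / (4 * N * ‖Q⁻¹‖)) (b / (2 * C))) with hτ
  have hτ1 : τ ≤ w / 2 := min_le_left _ _
  have hτ2 : τ ≤ delta Q ε / (4 * N * ‖Q⁻¹‖) := (min_le_right _ _).trans (min_le_left _ _)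
  have hτ3 : τ * C < b := by
    have h1 : τ ≤ b / (2 * C) := (min_le_right _ _).trans (min_le_right _ _)
    rw [le_div_iff₀ (by positivity)] at h1
    linarith
  intro e he t ht
  obtain ⟨⟨V, hVH, hVW, hρ⟩, herr⟩ := he t ht
  have hW := smul_one_le_bigW hM hN hQ hU hε hγ ht
  have hWH := isHermitian_of_nonneg (bigW_nonneg Q ε γ e t)
  have hV := smul_one_le_of_norm_sub_le hW hWH hVH hVW.le
  rw [← hw] at hV hW
  have hwτ : 0 < w - τ := by linarith
  have hV0 : 0 ≤ V := (smul_nonneg hwτ.le zero_le_one).trans hV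
  have hVp : 0 < V.trace.re := by
    have h1 := trace_re_mono hV
    rw [trace_real_smul_re, trace_one_re] at h1
    have h2 : (0 : ℝ) < Fintype.card (Fin M × Fin N) := by exact_mod_cast Fintype.card_pos
    exact lt_of_lt_of_le (by positivity) h1
  have hdens : IsDensity (e t).rho := by
    rw [hρ]
    exact isDensity_normalize hV0 hVp
  refine ⟨⟨hdens, herr.trans_le hτ2⟩, fun hr => ?_⟩
  have hs := smallS_pos hM hN hU hε hr
  have hY0 := Record.Y_nonneg hs
  have hD : (Phi Q (e t).rho - (e t).decomp).IsHermitian :=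
    (Phi_isHermitian Q hdens.1.isHermitian).sub
      (by rw [Record.decomp_eq]; exact specOp_isHermitian _ _)
  have h1 := (neg_le_abs _).trans (abs_trace_mul_re_le hD hY0)
  rw [sub_mul, Matrix.trace_sub, Complex.sub_re, Record.trace_decomp_mul_Y hs] at h1
  have h2 : ‖Phi Q (e t).rho - (e t).decomp‖ * ((e t).Y γ).trace.re ≤ τ * γ :=
    mul_le_mul herr.le (Record.trace_Y_le hγ hs) (trace_re_nonneg hY0) (by positivity)
  rw [← hsInner_PhiStar Q hdens.1.isHermitian, hρ, hsInner_normalize hVH] at h1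
  have h3 := trace_div_sub_trace_div_le hw0 hW hV0 hVp hWH hVW.le
    (loss_nonneg hM hN hU hε hr) (loss_le_one hM hN hQ hU hε hr)
  rw [loss, Matrix.mul_smul, Matrix.mul_smul, trace_real_smul_re, trace_real_smul_re,
    mul_div_assoc, mul_div_assoc, ← mul_sub, ← le_div_iff₀' hδ] at h3
  have h4 : 2 * τ / w / delta Q ε + τ * γ = τ * C := by
    rw [hC]
    field_simp
  rw [RejectPrecision, hsInner_normalize hWH]
  rw [← hρ] at h1
  linarith

end Runs

end QIP2

/-! ### The main theorem -/

open QIP2 in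
theorem mainTheorem2 (M N : ℕ) (hMN : 2 ≤ N * M)
    (Q : BiOp M N) (hQ : IsInteractiveMeasurement Q) (hQinv : IsUnit Q)
    (ε γ : ℝ) (hε : 0 < ε) (hγ : 0 < γ) :
    -- `μ(Q)` is a maximum, and it is stable under perturbations of `Q`
    IsGreatest (acceptanceValues Q) (mu Q) ∧
    (∀ R : BiOp M N, 0 ≤ R →
      |mu Q - mu R| ≤ N * ‖Q - R‖ ∧ (‖Q - R‖ < ε * γ / N → |mu Q - mu R| < ε * γ)) ∧
    -- the number of iterations
    (∀ e : ℕ → Record M N, iterations Q ε γ e ≤ bigT Q ε γ ∧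
      ((∃ t, AcceptsAt Q ε γ e t) ∨ Rejects Q ε γ e)) ∧
    (ε ≤ 1 → γ ≤ 1 →
      (bigT Q ε γ : ℝ) ≤ 25 * (Real.log ((N : ℝ) * M) / (ε ^ 3 * γ ^ 3 * delta Q ε))) ∧
    -- the error-free algorithm
    (∃ e : ℕ → Record M N, IsExactRun Q ε γ e) ∧
    (∀ e : ℕ → Record M N, IsExactRun Q ε γ e →
      ((∃ t, AcceptsAt Q ε γ e t) →
        (∃ X : BiOp M N, PrimalFeasible Q X ∧ (1 - ε) * γ ≤ X.trace.re) ∧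
          (1 - ε) * γ ≤ mu Q) ∧
      (Rejects Q ε γ e →
        (∃ Y : Op N, DualFeasible Q Y ∧ Y.trace.re ≤ (1 + ε) * γ) ∧
          mu Q ≤ (1 + ε) * γ)) ∧
    -- the algorithm with limited precision
    (∀ e : ℕ → Record M N,
      (∀ t, AcceptsAt Q ε γ e t → AcceptPrecision Q ε (e t) →
        (∃ X : BiOp M N, PrimalFeasible Q X ∧ (1 - 2 * ε) * γ ≤ X.trace.re) ∧
          (1 - 2 * ε) * γ ≤ mu Q) ∧
      (Rejects Q ε γ e → (∀ t < bigT Q ε γ, RejectPrecision Q ε γ e t) →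
        (∃ Y : Op N, DualFeasible Q Y ∧ Y.trace.re ≤ (1 + ε) * γ) ∧
          mu Q ≤ (1 + ε) * γ)) ∧
    -- sufficiently accurate exponentials and spectral decompositions give that precision
    (∃ τ : ℝ, 0 < τ ∧ ∀ e : ℕ → Record M N, IsApproxRun Q ε γ τ e →
      ∀ t, Reached Q ε γ e t → AcceptPrecision Q ε (e t) ∧
        (¬ (e t).AcceptTest Q ε γ → RejectPrecision Q ε γ e t)) := by
  have hM : 0 < M := Nat.pos_of_ne_zero fun h => by simp [h] at hMN
  have hN : 0 < N := Nat.pos_of_ne_zero fun h => by simp [h] at hMN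
  have hN' : (0 : ℝ) < N := by exact_mod_cast hN
  have hQ0 := hQ.nonneg
  have primal : ∀ {c : ℝ}, (∃ X : BiOp M N, PrimalFeasible Q X ∧ c ≤ X.trace.re) →
      (∃ X : BiOp M N, PrimalFeasible Q X ∧ c ≤ X.trace.re) ∧ c ≤ mu Q := fun h =>
    ⟨h, by
      obtain ⟨X, hX, hc⟩ := h
      exact hc.trans (trace_le_mu_of_primalFeasible hM hQ0 hQinv hX)⟩
  have dual : ∀ {c : ℝ}, (∃ Y : Op N, DualFeasible Q Y ∧ Y.trace.re ≤ c) →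
      (∃ Y : Op N, DualFeasible Q Y ∧ Y.trace.re ≤ c) ∧ mu Q ≤ c := fun h =>
    ⟨h, by
      obtain ⟨Y, hY, hc⟩ := h
      exact (mu_le_trace_of_dualFeasible hM hQ0 hQinv hY).trans hc⟩
  refine ⟨isGreatest_mu hM Q, fun R hR => ?_, fun e => ⟨iterations_le_bigT Q ε γ e,
    accepts_or_rejects Q ε γ e⟩, bigT_le hMN hQinv hε hγ, exists_exactRun Q ε γ,
    fun e he => ⟨?_, fun hrej => dual ?_⟩, fun e => ⟨fun t ht hp => primal ?_,
    fun hrej hp => dual ?_⟩, exists_precision hM hN hQ hQinv hε hγ⟩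
  · have h := abs_mu_sub_mu_le hM (isHermitian_of_nonneg hQ0) (isHermitian_of_nonneg hR)
    refine ⟨h, fun hlt => h.trans_lt ?_⟩
    rwa [lt_div_iff₀' hN'] at hlt
  · rintro ⟨t, ht, hacc⟩
    exact primal (exists_primalFeasible_of_exact hM hN hQ0 hQinv hε hγ
      (he.isDensity hM hN ht) (he t ht).2 hacc)
  · exact exists_dualFeasible_of_rejects hMN hQ hQinv hε hγ hrej fun t ht =>
      he.rejectPrecision hM hN hQinv hε hγ (hrej.reached ht) (hrej t ht)
  · exact exists_primalFeasible_of_acceptPrecision hM hN hQ hQinv hε hγ hp ht.2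
  · exact exists_dualFeasible_of_rejects hMN hQ hQinv hε hγ hrej hp
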